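/- Let $k$ be a field of characteristic $0$, and let $\mathscr C$ be one of the following five categories, each with objects $[n]=\{1,\dots,n\}$, $n\geqslant 1$: $\mathrm{FA}$ (all maps), $\mathrm{OA}$ (order-preserving maps, i.e. $i\leqslant j\Rightarrow f(i)\leqslant f(j)$), $\mathrm{CA}$ (cyclic-order-preserving maps, i.e. composites $f_0\circ\sigma$ of a cyclic rotation $\sigma$ followed by an order-preserving map $f_0$), $\mathrm{BA}$ (betweenness-preserving maps, i.e. order-preserving or order-reversing maps), $\mathrm{SA}$ (separation-preserving maps, i.e. maps which preserve or reverse the cyclic order). A $\mathscr C$-module is a functor $\mathscr C\to k\text{-Mod}$. Let $G_n=\operatorname{Aut}_{\mathscr C}([n])$; let $\Delta_n$ be the quotient of $k\mathscr C([n],-)$ by the submodule spanned by the non-injective maps, with its right $G_n$-action by precomposition; and for an irreducible representation $\lambda$ of $G_n$ over $k$ let $\Delta_{n,\lambda}=\Delta_n\otimes_{kG_n}\lambda$ (the indecomposable standard modules). Let $\sigma$ denote the rotation $i\mapsto i+1 \pmod n$ and $\tau$ the reflection $i\mapsto n+1-i$ of $[n]$. Call $\lambda$ singular if it is one-dimensional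 and - $\mathscr C=\mathrm{FA}$: $\lambda$ is the sign character of $G_n=S_n$; - $\mathscr C=\mathrm{OA}$: $\lambda$ is the trivial character of the trivial group $G_n$; - $\mathscr C=\mathrm{CA}$: $\lambda(\sigma)=(-1)^{n-1}$; - $\mathscr C=\mathrm{BA}$: $\lambda(\tau)=1$ or $\lambda(\tau)=-1$; - $\mathscr C=\mathrm{SA}$: $\lambda(\sigma)=(-1)^{n-1}$ and $\lambda(\tau)=\pm1$ (two characters of the dihedral group $G_n$ for $n\geqslant 3$; only the sign character of $G_2\cong C_2$ for $n=2$, where $\sigma=\tau$; the trivial character for $n=1$). Call $\lambda$ regular otherwise. Then for every $n\geqslant1$ and every irreducible representation $\lambda$ of $G_n$: 1. if $\lambda$ is regular, then $\Delta_{n,\lambda}$ is an irreducible $\mathscr C$-module; 2. if $\lambda$ is singular, then $\Delta_{n,\lambda}$ has length exactly $2$. -/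

import Mathlib

open CategoryTheory
open scoped TensorProduct

universe u

namespace Cameron

/-! ### Cyclically monotone maps -/

/-- The reversal `i ↦ m - 1 - i` of `Fin m` (that is, `i ↦ m + 1 - i` on `{1, …, m}`). -/
abbrev reversal (m : ℕ) : Equiv.Perm (Fin m) := Fin.revPerm

/-- `f` preserves the (non-strict) cyclic order: the word `f 0, f 1, …, f (m - 1)` is a cyclic
rotation of a weakly increasing word. Equivalently, `f` is an order-preserving map precomposed
with a rotation. -/
def IsCyclicMonotone {m n : ℕ} (f : Fin m → Fin n) : Prop :=
  ∃ p : ℤ, Monotone (f ∘ ⇑(finRotate m ^ p))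

theorem finRotate_pow_val {m : ℕ} (c : ℕ) (i : Fin m) :
    (((finRotate m ^ c) i : Fin m) : ℕ) = (i + c) % m := by
  induction c with
  | zero => simp [Nat.mod_eq_of_lt i.isLt]
  | succ c ih =>
    obtain ⟨m, rfl⟩ := Nat.exists_eq_succ_of_ne_zero i.pos.ne'
    rw [pow_succ', Equiv.Perm.mul_apply, finRotate_apply, Fin.val_add, ih, Fin.val_one']
    simp [← Nat.add_assoc]

theorem IsCyclicMonotone.of_monotone {m n : ℕ} {f : Fin m → Fin n} (hf : Monotone f) :
    IsCyclicMonotone f := ⟨0, by simpa using hf⟩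

theorem rotate_comp_monotone {m n : ℕ} {f : Fin m → Fin n} (hf : Monotone f) :
    IsCyclicMonotone (⇑(finRotate n) ∘ f) := by
  classical
  cases n with
  | zero => exact ⟨0, fun i => (f i).elim0⟩
  | succ n =>
  have hex : ∃ c : ℕ, ∀ j : Fin m, c ≤ j → f j = Fin.last n :=
    ⟨m, fun j hj => absurd j.isLt (by omega)⟩
  have hc := Nat.find_spec hex
  have hmin : ∀ j : Fin m, (j : ℕ) < Nat.find hex → f j ≠ Fin.last n := by
    intro j hj h
    refine Nat.find_min hex hj fun i hi => ?_
    have := hf (show j ≤ i from hi)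
    rw [h] at this
    exact le_antisymm (Fin.le_last _) this
  have hle : Nat.find hex ≤ m := Nat.find_min' hex fun j hj => absurd j.isLt (by omega)
  generalize Nat.find hex = c at hc hmin hle
  refine ⟨(c : ℤ), fun i j hij => ?_⟩
  rw [zpow_natCast]
  have hi := finRotate_pow_val c i
  have hj := finRotate_pow_val c j
  have hij' : (i : ℕ) ≤ j := hij
  have hm := j.isLt
  have him := i.isLt
  simp only [Function.comp_apply]
  generalize (finRotate m ^ c) i = a at hi
  generalize (finRotate m ^ c) j = b at hj
  rw [Fin.le_def]
  by_cases h1 : (i : ℕ) + c < m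
  · rw [Nat.mod_eq_of_lt h1] at hi
    rw [hc a (by omega), finRotate_last]
    simp
  · have e1 : ((i : ℕ) + c) % m = i + c - m := by
      rw [Nat.mod_eq_sub_mod (by omega), Nat.mod_eq_of_lt (by omega)]
    have e2 : ((j : ℕ) + c) % m = j + c - m := by
      rw [Nat.mod_eq_sub_mod (by omega), Nat.mod_eq_of_lt (by omega)]
    have ha := hmin a (by omega)
    have hb := hmin b (by omega)
    rw [coe_finRotate_of_ne_last ha, coe_finRotate_of_ne_last hb]
    have hab : a ≤ b := by rw [Fin.le_def]; omega
    have := hf hab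
    rw [Fin.le_def] at this
    omega

theorem IsCyclicMonotone.rotate_comp {m n : ℕ} {f : Fin m → Fin n} (hf : IsCyclicMonotone f) :
    IsCyclicMonotone (⇑(finRotate n) ∘ f) := by
  obtain ⟨p, hp⟩ := hf
  obtain ⟨q, hq⟩ := rotate_comp_monotone hp
  refine ⟨p + q, ?_⟩
  rw [zpow_add]
  exact hq

theorem IsCyclicMonotone.rotate_pow_comp {m n : ℕ} {f : Fin m → Fin n}
    (hf : IsCyclicMonotone f) (c : ℕ) : IsCyclicMonotone (⇑(finRotate n ^ c) ∘ f) := by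
  induction c with
  | zero => simpa using hf
  | succ c ih =>
    rw [pow_succ']
    exact ih.rotate_comp

theorem IsCyclicMonotone.rotate_zpow_comp {m n : ℕ} {f : Fin m → Fin n}
    (hf : IsCyclicMonotone f) (c : ℤ) : IsCyclicMonotone (⇑(finRotate n ^ c) ∘ f) := by
  obtain ⟨d, hd⟩ : ∃ d : ℕ, finRotate n ^ d = finRotate n ^ c :=
    (isOfFinOrder_of_finite (finRotate n)).mem_powers_iff_mem_zpowers.mpr ⟨c, rfl⟩
  rw [← hd]
  exact hf.rotate_pow_comp d

theorem IsCyclicMonotone.comp {l m n : ℕ} {g : Fin m → Fin n} {f : Fin l → Fin m}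
    (hg : IsCyclicMonotone g) (hf : IsCyclicMonotone f) : IsCyclicMonotone (g ∘ f) := by
  obtain ⟨p, hp⟩ := hg
  obtain ⟨q, hq⟩ := hf.rotate_zpow_comp (-p)
  refine ⟨q, ?_⟩
  have h := hp.comp hq
  have e : (g ∘ ⇑(finRotate m ^ p)) ∘ ((⇑(finRotate m ^ (-p)) ∘ f) ∘ ⇑(finRotate l ^ q))
      = (g ∘ f) ∘ ⇑(finRotate l ^ q) := by
    funext x
    simp [Function.comp]
  rwa [e] at h

theorem reversal_mul_rotate (m : ℕ) :
    reversal m * finRotate m * (reversal m)⁻¹ = (finRotate m)⁻¹ := by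
  rw [eq_inv_iff_mul_eq_one]
  ext i
  obtain ⟨m, rfl⟩ := Nat.exists_eq_succ_of_ne_zero i.pos.ne'
  have h1 : (reversal (m + 1))⁻¹ = reversal (m + 1) := rfl
  simp only [h1, Equiv.Perm.mul_apply, Fin.revPerm_apply, Equiv.Perm.one_apply, Fin.val_rev,
    coe_finRotate, Fin.ext_iff, Fin.val_last]
  have := i.isLt
  split_ifs <;> omega

theorem reversal_mul_rotate_zpow (m : ℕ) (p : ℤ) :
    reversal m * finRotate m ^ p * (reversal m)⁻¹ = finRotate m ^ (-p) := by
  rw [← conj_zpow, reversal_mul_rotate, inv_zpow, zpow_neg]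

/-- Conjugating by reversals preserves cyclic monotonicity. -/
theorem IsCyclicMonotone.conj_reversal {m n : ℕ} {g : Fin m → Fin n} (hg : IsCyclicMonotone g) :
    IsCyclicMonotone (⇑(reversal n) ∘ g ∘ ⇑(reversal m)) := by
  obtain ⟨p, hp⟩ := hg
  refine ⟨-p, fun i j hij => ?_⟩
  have h1 : ∀ x, reversal m ((finRotate m ^ (-p)) x) = (finRotate m ^ p) (Fin.rev x) := by
    intro x
    rw [← reversal_mul_rotate_zpow]
    simp [Equiv.Perm.mul_apply, Equiv.Perm.inv_def]
  simp only [Function.comp_apply, h1]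
  exact Fin.rev_le_rev.mpr (hp (Fin.rev_le_rev.mpr hij))

/-! ### The five categories -/

/-- The five highly homogeneous structures in Cameron's classification. -/
inductive Kind
  /-- pure sets -/
  | FA
  /-- linear orders -/
  | OA
  /-- cyclic orders -/
  | CA
  /-- linear betweenness -/
  | BA
  /-- separation -/
  | SA

/-- The structure-preserving maps `[m] → [n]` (with `[m] = Fin m`): all maps for `FA`;
order-preserving maps for `OA`; cyclic-order-preserving maps for `CA`; order-preserving or
order-reversing maps for `BA`; maps preserving or reversing the cyclic order for `SA`. -/
def IsHom {m n : ℕ} : Kind → (Fin m → Fin n) → Prop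
  | .FA, _ => True
  | .OA, f => Monotone f
  | .CA, f => IsCyclicMonotone f
  | .BA, f => Monotone f ∨ Antitone f
  | .SA, f => IsCyclicMonotone f ∨ IsCyclicMonotone (⇑(reversal n) ∘ f)

theorem isHom_id (t : Kind) (m : ℕ) : IsHom t (id : Fin m → Fin m) := by
  cases t with
  | FA => trivial
  | OA => exact monotone_id
  | CA => exact .of_monotone monotone_id
  | BA => exact .inl monotone_id
  | SA => exact .inl (.of_monotone monotone_id)

theorem IsHom.comp {t : Kind} {l m n : ℕ} {g : Fin m → Fin n} {f : Fin l → Fin m}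
    (hg : IsHom t g) (hf : IsHom t f) : IsHom t (g ∘ f) := by
  cases t with
  | FA => trivial
  | OA => exact Monotone.comp hg hf
  | CA => exact IsCyclicMonotone.comp hg hf
  | BA =>
    rcases hg with hg | hg <;> rcases hf with hf | hf
    · exact .inl (hg.comp hf)
    · exact .inr (hg.comp_antitone hf)
    · exact .inr (hg.comp_monotone hf)
    · exact .inl (hg.comp hf)
  | SA =>
    have key : ∀ {h : Fin m → Fin n}, IsCyclicMonotone h →
        IsCyclicMonotone (⇑(reversal m) ∘ f) → IsCyclicMonotone (⇑(reversal n) ∘ h ∘ f) := by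
      intro h hh hf'
      have e : ⇑(reversal n) ∘ h ∘ f
          = (⇑(reversal n) ∘ h ∘ ⇑(reversal m)) ∘ (⇑(reversal m) ∘ f) := by
        funext x; simp
      rw [e]
      exact hh.conj_reversal.comp hf'
    rcases hg with hg | hg <;> rcases hf with hf | hf
    · exact .inl (hg.comp hf)
    · exact .inr (key hg hf)
    · exact .inr (IsCyclicMonotone.comp (g := ⇑(reversal n) ∘ g) hg hf)
    · refine .inl ?_
      have := key hg hf
      have e : ⇑(reversal n) ∘ (⇑(reversal n) ∘ g) ∘ f = g ∘ f := by
        funext x; simp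
      rwa [e] at this

/-- The objects `[1], [2], …` of the category of kind `t`. -/
@[ext]
structure Obj (t : Kind) where
  /-- the number of points -/
  size : ℕ
  size_pos : 0 < size

instance (t : Kind) : Category.{0} (Obj t) where
  Hom X Y := { f : Fin X.size → Fin Y.size // IsHom t f }
  id X := ⟨id, isHom_id t X.size⟩
  comp f g := ⟨g.1 ∘ f.1, g.2.comp f.2⟩

variable {t : Kind}

/-- The map of underlying sets of a morphism. -/
def toFun {X Y : Obj t} (f : X ⟶ Y) : Fin X.size → Fin Y.size := f.1

@[simp] theorem toFun_id (X : Obj t) : toFun (𝟙 X) = id := rfl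

@[simp] theorem toFun_comp {X Y Z : Obj t} (f : X ⟶ Y) (g : Y ⟶ Z) :
    toFun (f ≫ g) = toFun g ∘ toFun f := rfl

/-- The automorphism given by a permutation which, with its inverse, preserves the structure. -/
def autOfPerm (X : Obj t) (σ : Equiv.Perm (Fin X.size)) (h : IsHom t ⇑σ) (h' : IsHom t ⇑σ⁻¹) :
    Aut X where
  hom := ⟨σ, h⟩
  inv := ⟨⇑σ⁻¹, h'⟩
  hom_inv_id := Subtype.ext (funext fun x => σ.symm_apply_apply x)
  inv_hom_id := Subtype.ext (funext fun x => σ.apply_symm_apply x)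

/-- The permutation of the underlying set given by an automorphism. -/
def toPerm {X : Obj t} (a : Aut X) : Equiv.Perm (Fin X.size) where
  toFun := toFun a.hom
  invFun := toFun a.inv
  left_inv x := congrFun (congrArg toFun a.hom_inv_id) x
  right_inv x := congrFun (congrArg toFun a.inv_hom_id) x

theorem isCyclicMonotone_rotate_zpow (m : ℕ) (p : ℤ) :
    IsCyclicMonotone ⇑(finRotate m ^ p) :=
  (IsCyclicMonotone.of_monotone monotone_id).rotate_zpow_comp p

/-- The rotation `i ↦ i + 1` as an automorphism for cyclic orders. -/
def rotCA (X : Obj .CA) : Aut X :=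
  autOfPerm X (finRotate X.size)
    (by simpa [IsHom] using isCyclicMonotone_rotate_zpow X.size 1)
    (by simpa [IsHom] using isCyclicMonotone_rotate_zpow X.size (-1))

/-- The rotation `i ↦ i + 1` as an automorphism for separation relations. -/
def rotSA (X : Obj .SA) : Aut X :=
  autOfPerm X (finRotate X.size)
    (.inl (by simpa using isCyclicMonotone_rotate_zpow X.size 1))
    (.inl (by simpa using isCyclicMonotone_rotate_zpow X.size (-1)))

/-- The order reversal as an automorphism for linear betweenness. -/
def revBA (X : Obj .BA) : Aut X :=
  autOfPerm X (reversal X.size) (.inr Fin.rev_anti) (.inr Fin.rev_anti)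

theorem isHom_reversal_SA (m : ℕ) : IsHom .SA ⇑(reversal m) := by
  refine .inr (.of_monotone ?_)
  have e : ⇑(reversal m) ∘ ⇑(reversal m) = id := by funext x; simp
  rw [e]
  exact monotone_id

/-- The reflection `i ↦ m + 1 - i` as an automorphism for separation relations. -/
def revSA (X : Obj .SA) : Aut X :=
  autOfPerm X (reversal X.size) (isHom_reversal_SA _) (isHom_reversal_SA _)

/-! ### Singular characters -/

/-- The singular representations of `G_n = Aut [n]`: for `FA` the sign character of `S_n`; for `OA`
the trivial one; for `CA` the character of `C_n` with `rotation ↦ (-1)^(n-1)`; for `BA` the trivial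
character and the character with `reversal ↦ -1`; for `SA` the characters with
`rotation ↦ (-1)^(n-1)` and `reflection ↦ ± 1`. -/
def IsSingular {k : Type*} [Field k] {V : Type*} [AddCommGroup V] [Module k V] :
    {t : Kind} → {X : Obj t} → Representation k (Aut X) V → Prop
  | .FA, X, ρ => Module.finrank k V = 1 ∧
      ∀ a : Aut X, ρ a = ((Equiv.Perm.sign (toPerm a) : ℤ) : k) • (1 : V →ₗ[k] V)
  | .OA, X, ρ => Module.finrank k V = 1 ∧ ∀ a : Aut X, ρ a = 1
  | .CA, X, ρ => Module.finrank k V = 1 ∧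
      ρ (rotCA X) = ((-1 : k) ^ (X.size - 1)) • (1 : V →ₗ[k] V)
  | .BA, X, ρ => Module.finrank k V = 1 ∧ (ρ (revBA X) = 1 ∨ ρ (revBA X) = -1)
  | .SA, X, ρ => Module.finrank k V = 1 ∧
      ρ (rotSA X) = ((-1 : k) ^ (X.size - 1)) • (1 : V →ₗ[k] V) ∧
      (ρ (revSA X) = 1 ∨ ρ (revSA X) = -1)

/-! ### Standard modules -/

noncomputable section

/-- The span of the non-injective morphisms `X ⟶ Y` in `k[Hom(X, Y)]`. -/
def nonInj (k : Type u) [Field k] (X Y : Obj t) : Submodule k ((X ⟶ Y) →₀ k) :=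
  Submodule.span k {x | ∃ f : X ⟶ Y, ¬ Function.Injective (toFun f) ∧ x = Finsupp.single f 1}

theorem nonInj_le_post (k : Type u) [Field k] (X : Obj t) {Y Z : Obj t} (g : Y ⟶ Z) :
    nonInj k X Y ≤ (nonInj k X Z).comap (Finsupp.lmapDomain k k (fun f : X ⟶ Y => f ≫ g)) := by
  refine Submodule.span_le.mpr ?_
  rintro _ ⟨f, hf, rfl⟩
  refine Submodule.subset_span ⟨f ≫ g, fun h => hf ?_, by simp⟩
  rw [toFun_comp] at h
  exact h.of_comp

theorem nonInj_le_pre (k : Type u) [Field k] {X : Obj t} (Y : Obj t) (a : Aut X) :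
    nonInj k X Y ≤ (nonInj k X Y).comap (Finsupp.lmapDomain k k (fun f : X ⟶ Y => a.hom ≫ f)) := by
  refine Submodule.span_le.mpr ?_
  rintro _ ⟨f, hf, rfl⟩
  refine Submodule.subset_span ⟨a.hom ≫ f, fun h => hf ?_, by simp⟩
  rw [toFun_comp] at h
  have e : toFun f = (toFun f ∘ toFun a.hom) ∘ ⇑(toPerm a).symm := by
    funext x
    exact congrArg (toFun f) ((toPerm a).apply_symm_apply x).symm
  rw [e]
  exact h.comp (toPerm a).symm.injective

/-- The standard module `Δ_X = k Hom(X, -) / (non-injective morphisms)`. -/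
def standard (k : Type u) [Field k] (X : Obj t) : Obj t ⥤ ModuleCat.{u} k where
  obj Y := ModuleCat.of k (((X ⟶ Y) →₀ k) ⧸ nonInj k X Y)
  map g := ModuleCat.ofHom (Submodule.mapQ _ _ _ (nonInj_le_post k X g))
  map_id Y := by
    ext f
    simp
  map_comp g h := by
    ext f
    simp

/-- The right action of `a ∈ Aut X` on `Δ_X(Y)`, induced by `f ↦ f ∘ a`. -/
def rightAct (k : Type u) [Field k] {X : Obj t} (Y : Obj t) (a : Aut X) :
    (standard k X).obj Y →ₗ[k] (standard k X).obj Y :=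
  Submodule.mapQ (nonInj k X Y) (nonInj k X Y) _ (nonInj_le_pre k Y a)

theorem rightAct_map (k : Type u) [Field k] {X Y Z : Obj t} (a : Aut X) (g : Y ⟶ Z)
    (x : (standard k X).obj Y) :
    rightAct k Z a ((standard k X).map g x) = (standard k X).map g (rightAct k Y a x) := by
  have h : rightAct k Z a ∘ₗ ((standard k X).map g).hom
      = ((standard k X).map g).hom ∘ₗ rightAct k Y a := by
    refine Submodule.linearMap_qext _ (Finsupp.lhom_ext' fun f => LinearMap.ext_ring ?_)
    change Submodule.Quotient.mk (Finsupp.lmapDomain k k (fun f : X ⟶ Z => a.hom ≫ f)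
        (Finsupp.lmapDomain k k (fun f : X ⟶ Y => f ≫ g) (Finsupp.single f 1))) =
      Submodule.Quotient.mk (Finsupp.lmapDomain k k (fun f : X ⟶ Y => f ≫ g)
        (Finsupp.lmapDomain k k (fun f : X ⟶ Y => a.hom ≫ f) (Finsupp.single f 1)))
    simp
  exact LinearMap.congr_fun h x

variable {k : Type u} [Field k] {V : Type u} [AddCommGroup V] [Module k V]

/-- The relations `(x · a) ⊗ v = x ⊗ (a · v)` defining `Δ_X(Y) ⊗_{k Aut X} V` as a quotient of
`Δ_X(Y) ⊗_k V`. -/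
def balanced {X : Obj t} (ρ : Representation k (Aut X) V) (Y : Obj t) :
    Submodule k ((standard k X).obj Y ⊗[k] V) :=
  Submodule.span k {z | ∃ (a : Aut X) (x : (standard k X).obj Y) (v : V),
    z = rightAct k Y a x ⊗ₜ[k] v - x ⊗ₜ[k] ρ a v}

theorem balanced_le {X : Obj t} (ρ : Representation k (Aut X) V) {Y Z : Obj t} (g : Y ⟶ Z) :
    balanced ρ Y ≤ (balanced ρ Z).comap (((standard k X).map g).hom.rTensor V) := by
  refine Submodule.span_le.mpr ?_
  rintro _ ⟨a, x, v, rfl⟩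
  refine Submodule.subset_span ⟨a, (standard k X).map g x, v, ?_⟩
  rw [rightAct_map]
  simp

/-- The module `Δ_{X,ρ} = Δ_X ⊗_{k Aut X} V`; for irreducible `ρ` this is the
indecomposable standard module attached to `ρ`. -/
def standardTwist {X : Obj t} (ρ : Representation k (Aut X) V) : Obj t ⥤ ModuleCat.{u} k where
  obj Y := ModuleCat.of k (((standard k X).obj Y ⊗[k] V) ⧸ balanced ρ Y)
  map g := ModuleCat.ofHom (Submodule.mapQ _ _ _ (balanced_le ρ g))
  map_id Y := by
    ext : 1
    refine Submodule.linearMap_qext _ ?_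
    refine TensorProduct.ext' fun x v => ?_
    simp
  map_comp g h := by
    ext : 1
    refine Submodule.linearMap_qext _ ?_
    refine TensorProduct.ext' fun x v => ?_
    simp

/-- The length of an object: the supremum of the lengths `n` of chains
`X_0 < X_1 < ⋯ < X_n = X` of subobjects. -/
def objLength {C : Type*} [Category* C] (X : C) : ℕ∞ :=
  Order.height (⊤ : Subobject X)

end

end Cameron

/-!
All five categories contain the monotone maps, and every injective morphism is uniquely an
automorphism followed by an increasing map (`exists_aut_comp_inc`, `aut_comp_inc_eq_inc`). Hence
`Δ_{X,ρ}(Y)` is the space of `V`-valued functions on the subsets of `Y` of size `|X|`; these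
coordinates are `coord`.

As `Δ_{X,ρ}` is generated by its value `V` at `X`, which is irreducible, every proper subfunctor
is contained in the radical, that is, the subfunctor of the elements killed by all morphisms to `X`
(`le_radical_or_eq_top`). So the theorem says that the radical is zero for regular `ρ`, and nonzero
and simple for singular `ρ`.

Monotone maps alone control the radical. Let `∂ v = ∑ (-1)^i d_i ⊗ v` be the boundary of the simplex
with one vertex more than `X`. Retractions onto maximal subsets of the support show that an element
killed by the monotone maps to `X` is determined by its coordinates at the subsets `S` which do not
contain the least point (`eq_zero_of_support`). These coordinates are the coefficients of the
element as a combination of boundaries of the simplices `S ∪ {0}` (`eq_sum_map_boundary`), and they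
are detected by monotone maps to the object with `|X| + 1` points (`coord_eq_zero_of_map_succObj`).
Consequently a nonzero subfunctor of the radical contains some `∂ v` with `v ≠ 0`, and the radical
is contained in any subfunctor containing all the `∂ v`. In particular the radical has no proper
nonzero subfunctor when `V` is a line, and it is nonzero if and only if some `∂ v` with `v ≠ 0` is
killed by all morphisms to `X`.

It remains to see that the latter happens exactly for singular `ρ`. For a morphism `g` to `X`, the
image of `∂ v` is the alternating sum of the actions on `v` of the automorphisms that `g` induces
on the facets. The corresponding alternating sum of signs is zero, being the expansion of a
singular determinant (`sum_mapSign_succAbove`), so that `∂ v` is killed for singular `ρ`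
(`map_boundary_of_isSingular`). Conversely, identifying two vertices at distance two (for `FA`), or
the first and the last vertex (for `CA` and `SA`), gives the relations which characterize singular
representations (`isSingular_of_map_boundary`); for `OA` and `BA` all irreducible representations are
singular.
-/

namespace Cameron

/-! ### Subobjects of a functor to vector spaces -/

section StableFamily

variable {C : Type*} [Category* C] {k : Type u} [Field k]

/-- A subfunctor of `F : C ⥤ ModuleCat k`, as a family of submodules which is stable under the
maps of `F`; the order is pointwise inclusion. -/
abbrev StableFamily (F : C ⥤ ModuleCat.{u} k) : Type _ :=
  {W : ∀ Y, Submodule k (F.obj Y) // ∀ ⦃Y Z : C⦄ (g : Y ⟶ Z), ∀ x ∈ W Y, F.map g x ∈ W Z}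

namespace StableFamily

variable {F : C ⥤ ModuleCat.{u} k}

/-- The functor underlying a stable family of submodules. -/
noncomputable def toFunctor (W : StableFamily F) : C ⥤ ModuleCat.{u} k where
  obj Y := ModuleCat.of k (W.1 Y)
  map g := ModuleCat.ofHom ((F.map g).hom.restrict (W.2 g))
  map_id Y := by
    ext x
    change (F.map (𝟙 Y)).hom x.1 = x.1
    rw [F.map_id]
    rfl
  map_comp g h := by
    ext x
    change (F.map (g ≫ h)).hom x.1 = (F.map h).hom ((F.map g).hom x.1)
    rw [F.map_comp]
    rfl

/-- The inclusion of a stable family of submodules. -/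
noncomputable def incl (W : StableFamily F) : W.toFunctor ⟶ F where
  app Y := ModuleCat.ofHom (W.1 Y).subtype
  naturality Y Z g := by
    ext x
    rfl

instance (W : StableFamily F) : Mono W.incl := by
  rw [NatTrans.mono_iff_mono_app]
  intro Y
  rw [ModuleCat.mono_iff_injective]
  exact Subtype.val_injective

theorem mk_incl_le_mk_incl {W W' : StableFamily F} :
    Subobject.mk W.incl ≤ Subobject.mk W'.incl ↔ W ≤ W' := by
  constructor
  · intro h Y x hx
    have e := congrArg (fun φ => φ.app Y) (Subobject.ofMkLEMk_comp h)
    have e' := congrArg (fun φ => φ.hom (⟨x, hx⟩ : W.1 Y)) e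
    have e'' : (((Subobject.ofMkLEMk _ _ h).app Y).hom (⟨x, hx⟩ : W.1 Y) : W'.1 Y).1 = x := e'
    rw [← e'']
    exact Subtype.property _
  · intro h
    refine Subobject.mk_le_mk_of_comm
      { app := fun Y => ModuleCat.ofHom (Submodule.inclusion (h Y))
        naturality := fun Y Z g => ?_ } ?_
    · ext x
      rfl
    · ext Y x
      rfl

theorem exists_eq_mk_incl (N : Subobject F) : ∃ W : StableFamily F, Subobject.mk W.incl = N := by
  have hinj : ∀ Y, Function.Injective (N.arrow.app Y) := fun Y => by
    rw [← ModuleCat.mono_iff_injective]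
    exact (NatTrans.mono_iff_mono_app N.arrow).mp inferInstance Y
  have hnat : ∀ {Y Z : C} (g : Y ⟶ Z) x,
      N.arrow.app Z ((N : C ⥤ ModuleCat.{u} k).map g x) = F.map g (N.arrow.app Y x) :=
    fun g x => NatTrans.naturality_apply N.arrow g x
  let W : StableFamily F := ⟨fun Y => LinearMap.range (N.arrow.app Y).hom, by
    rintro Y Z g _ ⟨x, rfl⟩
    exact ⟨_, hnat g x⟩⟩
  refine ⟨W, (Subobject.eq_mk_of_comm W.incl (NatIso.ofComponents
    (fun Y => (LinearEquiv.ofInjective (N.arrow.app Y).hom (hinj Y)).toModuleIso) ?_) ?_).symm⟩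
  · intro Y Z g
    ext x
    exact Subtype.ext (hnat g x)
  · ext Y x
    rfl

/-- Stable families of submodules are the same as subobjects. -/
noncomputable def subobjectIso (F : C ⥤ ModuleCat.{u} k) : StableFamily F ≃o Subobject F :=
  RelIso.ofSurjective
    (OrderEmbedding.ofMapLEIff (fun W : StableFamily F => Subobject.mk W.incl)
      fun _ _ => mk_incl_le_mk_incl)
    exists_eq_mk_incl

instance : BoundedOrder (StableFamily F) where
  top := ⟨fun _ => ⊤, fun _ _ _ _ _ => Submodule.mem_top⟩
  le_top _ _ := le_top
  bot := ⟨fun _ => ⊥, fun Y Z g x hx => by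
    rw [Submodule.mem_bot] at hx ⊢
    rw [hx, map_zero]⟩
  bot_le _ _ := bot_le

theorem simple_of_isSimpleOrder [IsSimpleOrder (StableFamily F)] : Simple F :=
  (simple_iff_subobject_isSimpleOrder F).mpr ((subobjectIso F).isSimpleOrder_iff.mp inferInstance)

/-- If the only subfunctors are `⊥ < R < ⊤`, the length is two. -/
theorem objLength_eq_two (R : StableFamily F) (h0 : ⊥ < R) (h1 : R < ⊤)
    (h : ∀ W : StableFamily F, W = ⊥ ∨ W = R ∨ W = ⊤) : objLength F = 2 := by
  have hR : Order.height R = 1 := by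
    refine Order.height_eq_coe_iff (n := 1) |>.mpr ⟨?_, .inr ⟨⊥, h0, by simp⟩, ?_⟩
    · refine lt_of_le_of_lt (Order.height_le_coe_iff (n := 1) |>.mpr fun W hW => ?_)
        (ENat.natCast_lt_top 1)
      rcases h W with rfl | rfl | rfl
      · simp
      · exact absurd hW (lt_irrefl _)
      · exact absurd hW not_top_lt
    · intro W hW
      rcases h W with rfl | rfl | rfl
      · simp
      · exact absurd hW (lt_irrefl _)
      · exact absurd hW not_top_lt
  rw [objLength, ← (subobjectIso F).map_top, Order.height_orderIso]
  apply le_antisymm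
  · refine Order.height_le_coe_iff (n := 2) |>.mpr fun W hW => ?_
    rcases h W with rfl | rfl | rfl
    · simp
    · rw [hR]; norm_num
    · exact absurd hW (lt_irrefl _)
  · have := Order.height_add_one_le h1
    rw [hR] at this
    exact this

end StableFamily

end StableFamily

variable {t : Kind}

/-! ### Injective morphisms -/

theorem IsHom.of_monotone {m n : ℕ} {f : Fin m → Fin n} (hf : Monotone f) : IsHom t f := by
  cases t with
  | FA => trivial
  | OA => exact hf
  | CA => exact .of_monotone hf
  | BA => exact .inl hf
  | SA => exact .inl (.of_monotone hf)

/-- A monotone map as a morphism; all five categories contain these. -/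
def monoHom {X Y : Obj t} (f : Fin X.size → Fin Y.size) (hf : Monotone f) : X ⟶ Y :=
  ⟨f, .of_monotone hf⟩

theorem hom_ext {X Y : Obj t} {f g : X ⟶ Y} (h : toFun f = toFun g) : f = g := Subtype.ext h

theorem isHom_rotate_zpow_CA (m : ℕ) (p : ℤ) : IsHom .CA ⇑(finRotate m ^ p) :=
  isCyclicMonotone_rotate_zpow m p

theorem isHom_rotate_zpow_SA (m : ℕ) (p : ℤ) : IsHom .SA ⇑(finRotate m ^ p) :=
  .inl (isCyclicMonotone_rotate_zpow m p)

/-- An injective structure-preserving map becomes increasing after precomposition with a suitable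
automorphism of its source. -/
theorem exists_aut_strictMono {X : Obj t} {m : ℕ} {f : Fin X.size → Fin m} (hf : IsHom t f)
    (hinj : Function.Injective f) : ∃ a : Aut X, StrictMono (f ∘ toFun a.hom) := by
  cases t with
  | FA =>
    exact ⟨autOfPerm X (Tuple.sort f) trivial trivial,
      (Tuple.monotone_sort f).strictMono_of_injective (hinj.comp (Tuple.sort f).injective)⟩
  | OA => exact ⟨1, Monotone.strictMono_of_injective hf hinj⟩
  | CA =>
    obtain ⟨p, hp⟩ := hf
    exact ⟨autOfPerm X (finRotate X.size ^ p) (isHom_rotate_zpow_CA _ _)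
      (by rw [← zpow_neg]; exact isHom_rotate_zpow_CA _ _),
      hp.strictMono_of_injective (hinj.comp (Equiv.injective _))⟩
  | BA =>
    rcases hf with hf | hf
    · exact ⟨1, hf.strictMono_of_injective hinj⟩
    · exact ⟨revBA X, (hf.comp Fin.rev_anti).strictMono_of_injective
        (hinj.comp Fin.rev_injective)⟩
  | SA =>
    rcases hf with ⟨p, hp⟩ | ⟨p, hp⟩
    · exact ⟨autOfPerm X (finRotate X.size ^ p) (isHom_rotate_zpow_SA _ _)
        (by rw [← zpow_neg]; exact isHom_rotate_zpow_SA _ _),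
        hp.strictMono_of_injective (hinj.comp (Equiv.injective _))⟩
    · refine ⟨autOfPerm X (finRotate X.size ^ p) (isHom_rotate_zpow_SA _ _)
        (by rw [← zpow_neg]; exact isHom_rotate_zpow_SA _ _) * revSA X, ?_⟩
      have h : Monotone (f ∘ ⇑(finRotate X.size ^ p) ∘ Fin.rev) := fun i j hij =>
        Fin.rev_le_rev.mp (hp (Fin.rev_le_rev.mpr hij))
      exact h.strictMono_of_injective
        (hinj.comp ((Equiv.injective _).comp Fin.rev_injective))

/-- Increasing maps, indexing the `n`-element subsets of `Fin m`; they carry the pointwise order. -/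
abbrev Inc (n m : ℕ) : Type := {S : Fin n → Fin m // StrictMono S}

/-- An increasing map as a morphism. -/
def Inc.hom {X Y : Obj t} (S : Inc X.size Y.size) : X ⟶ Y := monoHom S.1 S.2.monotone

@[simp] theorem Inc.toFun_hom {X Y : Obj t} (S : Inc X.size Y.size) :
    toFun (S.hom : X ⟶ Y) = S.1 := rfl

/-- The identity as an increasing map. -/
def Inc.refl (n : ℕ) : Inc n n := ⟨id, strictMono_id⟩

@[simp] theorem Inc.hom_refl (X : Obj t) : (Inc.refl X.size).hom = 𝟙 X := rfl

theorem Inc.eq_refl {n : ℕ} (S : Inc n n) : S = Inc.refl n :=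
  Subtype.ext (S.2.range_inj strictMono_id |>.mp (by
    rw [Set.range_id]; exact (Finite.surjective_of_injective S.2.injective).range_eq))

theorem exists_aut_comp_inc {X Y : Obj t} (f : X ⟶ Y) (hf : Function.Injective (toFun f)) :
    ∃ (a : Aut X) (S : Inc X.size Y.size), f = a.hom ≫ S.hom := by
  obtain ⟨a, ha⟩ := exists_aut_strictMono f.2 hf
  refine ⟨a⁻¹, ⟨_, ha⟩, ?_⟩
  have : (Inc.hom ⟨_, ha⟩ : X ⟶ Y) = a.hom ≫ f := rfl
  rw [this]
  exact (a.inv_hom_id_assoc f).symm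

theorem exists_aut_hom_eq {X : Obj t} (f : X ⟶ X) (hf : Function.Injective (toFun f)) :
    ∃ a : Aut X, a.hom = f := by
  obtain ⟨a, S, h⟩ := exists_aut_comp_inc f hf
  refine ⟨a, ?_⟩
  rw [h, S.eq_refl, Inc.hom_refl, Category.comp_id]

theorem toFun_aut_bijective {X : Obj t} (a : Aut X) : Function.Bijective (toFun a.hom) :=
  (toPerm a).bijective

theorem aut_eq_one_of_strictMono {X : Obj t} {a : Aut X} (ha : StrictMono (toFun a.hom)) :
    a = 1 := by
  have h := congrArg Subtype.val (Inc.eq_refl ⟨_, ha⟩)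
  exact Iso.ext (hom_ext h)

/-- The factorization of an injective morphism into an automorphism and an increasing map is
unique. -/
theorem aut_comp_inc_eq_inc {X Y : Obj t} {a : Aut X} {S T : Inc X.size Y.size}
    (h : a.hom ≫ S.hom = T.hom) : a = 1 ∧ S = T := by
  have h' : S.1 ∘ toFun a.hom = T.1 := congrArg toFun h
  have hST : S = T := by
    refine Subtype.ext (S.2.range_inj T.2 |>.mp ?_)
    rw [← h', (toFun_aut_bijective a).surjective.range_comp]
  subst hST
  refine ⟨aut_eq_one_of_strictMono ?_, rfl⟩
  rw [S.2.injective.comp_left (h'.trans (Function.comp_id _).symm)]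
  exact strictMono_id

theorem aut_comp_injective {X Y : Obj t} {a b : Aut X} {S : Inc X.size Y.size}
    (h : a.hom ≫ S.hom = b.hom ≫ S.hom) : a = b :=
  Iso.ext (hom_ext (S.2.injective.comp_left (congrArg toFun h)))

/-! ### Coordinates on the standard modules -/

noncomputable section

variable {k : Type u} [Field k] {V : Type u} [AddCommGroup V] [Module k V]
  {X : Obj t} (ρ : Representation k (Aut X) V)

variable (k) in
/-- The class of `f` in `Δ_X(Y)`. -/
def stdGen {Y : Obj t} (f : X ⟶ Y) : (standard k X).obj Y :=
  (nonInj k X Y).mkQ (Finsupp.single f 1)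

/-- The class of `f ⊗ v` in `Δ_{X,ρ}(Y)`. -/
def gen {Y : Obj t} (f : X ⟶ Y) : V →ₗ[k] (standardTwist ρ).obj Y :=
  (balanced ρ Y).mkQ ∘ₗ TensorProduct.mk k ((standard k X).obj Y) V (stdGen k f)

theorem gen_def {Y : Obj t} (f : X ⟶ Y) (v : V) :
    gen ρ f v = (balanced ρ Y).mkQ (stdGen k f ⊗ₜ[k] v) := rfl

theorem gen_of_not_injective {Y : Obj t} {f : X ⟶ Y} (hf : ¬ Function.Injective (toFun f)) :
    gen ρ f = 0 := by
  ext v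
  have : stdGen k f = 0 :=
    (Submodule.Quotient.mk_eq_zero _).mpr (Submodule.subset_span ⟨f, hf, rfl⟩)
  rw [gen_def, this, TensorProduct.zero_tmul, map_zero]
  rfl

theorem gen_aut_comp {Y : Obj t} (a : Aut X) (f : X ⟶ Y) (v : V) :
    gen ρ (a.hom ≫ f) v = gen ρ f (ρ a v) := by
  have h : stdGen k (a.hom ≫ f) = rightAct k Y a (stdGen k f) := by
    change _ = Submodule.Quotient.mk
      (Finsupp.lmapDomain k k (fun f : X ⟶ Y => a.hom ≫ f) (Finsupp.single f 1))
    rw [Finsupp.lmapDomain_apply, Finsupp.mapDomain_single]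
    rfl
  rw [gen_def, gen_def, h]
  exact (Submodule.Quotient.eq _).mpr (Submodule.subset_span ⟨a, _, v, rfl⟩)

theorem map_gen {Y Z : Obj t} (g : Y ⟶ Z) (f : X ⟶ Y) (v : V) :
    (standardTwist ρ).map g (gen ρ f v) = gen ρ (f ≫ g) v := by
  have h : (standard k X).map g (stdGen k f) = stdGen k (f ≫ g) := by
    change Submodule.Quotient.mk
      (Finsupp.lmapDomain k k (fun f : X ⟶ Y => f ≫ g) (Finsupp.single f 1)) = _
    rw [Finsupp.lmapDomain_apply, Finsupp.mapDomain_single]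
    rfl
  rw [gen_def, gen_def, ← h]
  rfl

/-- Linear maps out of `Δ_{X,ρ}(Y)` agree when they agree on the classes `f ⊗ v`. -/
theorem hom_ext_gen {Y : Obj t} {M : Type*} [AddCommGroup M] [Module k M]
    {φ ψ : (standardTwist ρ).obj Y →ₗ[k] M} (h : ∀ f v, φ (gen ρ f v) = ψ (gen ρ f v)) :
    φ = ψ := by
  refine Submodule.linearMap_qext _ (TensorProduct.ext ?_)
  refine Submodule.linearMap_qext _ (Finsupp.lhom_ext' fun f => LinearMap.ext_ring ?_)
  exact LinearMap.ext (h f)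

open Classical in
/-- The action on `V` of the automorphism `a` with `f = S ∘ a`, and zero if `f` does not have the
image of `S`. -/
def coordHom {Y : Obj t} (S : Inc X.size Y.size) (f : X ⟶ Y) : V →ₗ[k] V :=
  if h : ∃ a : Aut X, a.hom ≫ S.hom = f then ρ h.choose else 0

theorem coordHom_aut_comp {Y : Obj t} (S : Inc X.size Y.size) (a : Aut X) :
    coordHom ρ S (a.hom ≫ S.hom) = ρ a := by
  have h : ∃ b : Aut X, b.hom ≫ S.hom = a.hom ≫ S.hom := ⟨a, rfl⟩
  rw [coordHom, dif_pos h, aut_comp_injective h.choose_spec]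

theorem coordHom_eq_zero {Y : Obj t} {S : Inc X.size Y.size} {f : X ⟶ Y}
    (h : ∀ a : Aut X, a.hom ≫ S.hom ≠ f) : coordHom ρ S f = 0 :=
  dif_neg fun ⟨a, ha⟩ => h a ha

theorem coordHom_pre {Y : Obj t} (S : Inc X.size Y.size) (a : Aut X) (f : X ⟶ Y) :
    coordHom ρ S (a.hom ≫ f) = coordHom ρ S f ∘ₗ ρ a := by
  by_cases h : ∃ b : Aut X, b.hom ≫ S.hom = f
  · obtain ⟨b, rfl⟩ := h
    have : a.hom ≫ b.hom ≫ S.hom = (b * a).hom ≫ S.hom := (Category.assoc _ _ _).symm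
    rw [this, coordHom_aut_comp, coordHom_aut_comp, map_mul]
    rfl
  · rw [coordHom_eq_zero ρ fun b hb => h ⟨b, hb⟩, coordHom_eq_zero, LinearMap.zero_comp]
    intro b hb
    refine h ⟨b * a⁻¹, ?_⟩
    change (a.inv ≫ b.hom) ≫ S.hom = f
    rw [Category.assoc, hb, a.inv_hom_id_assoc]

/-- The coordinate at the subset `S` as a map out of `Δ_X(Y)`. -/
def coordStd {Y : Obj t} (S : Inc X.size Y.size) : (standard k X).obj Y →ₗ[k] V →ₗ[k] V :=
  (nonInj k X Y).liftQ (Finsupp.linearCombination k (coordHom ρ S)) (by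
    refine Submodule.span_le.mpr ?_
    rintro _ ⟨f, hf, rfl⟩
    change Finsupp.linearCombination k (coordHom ρ S) (Finsupp.single f 1) = 0
    rw [Finsupp.linearCombination_single, one_smul]
    refine coordHom_eq_zero ρ fun a ha => hf ?_
    rw [← ha, toFun_comp]
    exact S.2.injective.comp (toFun_aut_bijective a).injective)

theorem coordStd_rightAct {Y : Obj t} (S : Inc X.size Y.size) (a : Aut X)
    (x : (standard k X).obj Y) :
    coordStd ρ S (rightAct k Y a x) = coordStd ρ S x ∘ₗ ρ a := by
  have h : coordStd ρ S ∘ₗ rightAct k Y a = LinearMap.lcomp k V (ρ a) ∘ₗ coordStd ρ S := by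
    refine Submodule.linearMap_qext _ (Finsupp.lhom_ext' fun f => LinearMap.ext_ring ?_)
    change Finsupp.linearCombination k (coordHom ρ S)
      (Finsupp.lmapDomain k k (fun f : X ⟶ Y => a.hom ≫ f) (Finsupp.single f 1)) =
      (Finsupp.linearCombination k (coordHom ρ S) (Finsupp.single f 1)) ∘ₗ ρ a
    simp [coordHom_pre]
  exact LinearMap.congr_fun h x

/-- The coordinate of an element of `Δ_{X,ρ}(Y)` at the subset `S`: this identifies
`Δ_{X,ρ}(Y)` with the functions from the subsets of `Y` of size `|X|` to `V`. -/
def coord {Y : Obj t} (S : Inc X.size Y.size) : (standardTwist ρ).obj Y →ₗ[k] V :=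
  (balanced ρ Y).liftQ (TensorProduct.lift (coordStd ρ S)) (by
    refine Submodule.span_le.mpr ?_
    rintro _ ⟨a, x, v, rfl⟩
    change TensorProduct.lift (coordStd ρ S) _ = 0
    rw [map_sub, TensorProduct.lift.tmul, TensorProduct.lift.tmul, coordStd_rightAct, sub_eq_zero]
    rfl)

theorem coord_gen {Y : Obj t} (S : Inc X.size Y.size) (f : X ⟶ Y) (v : V) :
    coord ρ S (gen ρ f v) = coordHom ρ S f v := by
  change Finsupp.linearCombination k (coordHom ρ S) (Finsupp.single f 1) v = _
  simp

open Classical in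
theorem coord_gen_monotone {Y : Obj t} (S : Inc X.size Y.size) {f : X ⟶ Y}
    (hf : Monotone (toFun f)) (v : V) :
    coord ρ S (gen ρ f v) = if toFun f = S.1 then v else 0 := by
  rw [coord_gen]
  split_ifs with h
  · have : f = (1 : Aut X).hom ≫ S.hom := hom_ext h
    rw [this, coordHom_aut_comp, map_one]
    rfl
  · rw [coordHom_eq_zero]
    · rfl
    · rintro a rfl
      have hT : StrictMono (toFun (a.hom ≫ S.hom)) := hf.strictMono_of_injective
        (S.2.injective.comp (toFun_aut_bijective a).injective)
      have h2 := aut_comp_inc_eq_inc (a := a) (S := S) (T := ⟨_, hT⟩) rfl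
      exact h (congrArg Subtype.val h2.2).symm

open Classical in
theorem coord_gen_inc {Y : Obj t} (S T : Inc X.size Y.size)
    (v : V) : coord ρ S (gen ρ T.hom v) = if T = S then v else 0 := by
  rw [coord_gen_monotone ρ S (f := T.hom) T.2.monotone]
  exact if_congr (Subtype.ext_iff (a1 := T) (a2 := S)).symm rfl rfl

theorem sum_gen_coord {Y : Obj t} (x : (standardTwist ρ).obj Y) :
    ∑ S : Inc X.size Y.size, gen ρ S.hom (coord ρ S x) = x := by
  classical
  have h : ∑ S : Inc X.size Y.size, gen ρ S.hom ∘ₗ coord ρ S = LinearMap.id := by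
    refine hom_ext_gen ρ fun f v => ?_
    by_cases hf : Function.Injective (toFun f)
    · obtain ⟨a, T, rfl⟩ := exists_aut_comp_inc f hf
      rw [gen_aut_comp, LinearMap.sum_apply, Fintype.sum_eq_single T]
      · simp [coord_gen_inc]
      · intro S hS
        simp [coord_gen_inc, hS.symm]
    · rw [gen_of_not_injective ρ hf]
      simp
  simpa using LinearMap.congr_fun h x

theorem eq_zero_of_coord {Y : Obj t} {x : (standardTwist ρ).obj Y}
    (h : ∀ S : Inc X.size Y.size, coord ρ S x = 0) : x = 0 := by
  rw [← sum_gen_coord ρ x]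
  simp [h]

theorem gen_injective {Y : Obj t} (S : Inc X.size Y.size) : Function.Injective (gen ρ S.hom) := by
  classical
  intro v w h
  simpa [coord_gen_inc] using congrArg (coord ρ S) h

theorem exists_gen_id (x : (standardTwist ρ).obj X) : ∃ v, gen ρ (𝟙 X) v = x := by
  refine ⟨coord ρ (Inc.refl _) x, ?_⟩
  conv_rhs => rw [← sum_gen_coord ρ x]
  rw [Fintype.sum_eq_single (Inc.refl _) fun S hS => absurd S.eq_refl hS, Inc.hom_refl]

open Classical in
/-- The coordinates of the image of an element under a monotone map are sums of coordinates. -/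
theorem coord_map_monotone {Y Z : Obj t} {g : Y ⟶ Z} (hg : Monotone (toFun g))
    (T : Inc X.size Z.size) (x : (standardTwist ρ).obj Y) :
    coord ρ T ((standardTwist ρ).map g x) =
      ∑ S : Inc X.size Y.size, if toFun g ∘ S.1 = T.1 then coord ρ S x else 0 := by
  conv_lhs => rw [← sum_gen_coord ρ x, map_sum, map_sum]
  refine Finset.sum_congr rfl fun S _ => ?_
  rw [map_gen, coord_gen_monotone]
  · rfl
  · exact hg.comp S.2.monotone

end

/-! ### Monotone retractions -/

instance (X : Obj t) : NeZero X.size := ⟨X.size_pos.ne'⟩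

/-- The retraction onto the image of `S` sending `y` to the largest element of the image which is
at most `y` (and to the first element of the image if there is none). -/
theorem Inc.exists_retraction {n m : ℕ} [NeZero n] (S : Inc n m) :
    ∃ g : Fin m → Fin n, Monotone g ∧ (∀ i, g (S.1 i) = i) ∧ ∀ y, g y ≠ 0 → S.1 (g y) ≤ y := by
  refine ⟨fun y => (Finset.univ.filter fun i => S.1 i ≤ y).sup id, ?_, ?_, ?_⟩
  · intro y z hyz
    refine Finset.sup_mono fun i hi => ?_
    simp only [Finset.mem_filter, Finset.mem_univ, true_and] at hi ⊢
    exact hi.trans hyz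
  · intro i
    refine le_antisymm (Finset.sup_le fun j hj => ?_) (Finset.le_sup (f := id) (by simp))
    simp only [Finset.mem_filter, Finset.mem_univ, true_and] at hj
    exact S.2.le_iff_le.mp hj
  · intro y hy
    rcases (Finset.univ.filter fun i => S.1 i ≤ y).eq_empty_or_nonempty with h | h
    · exact absurd (by simp only [h, Finset.sup_empty]; rfl) hy
    · obtain ⟨i, hi, e⟩ := Finset.exists_mem_eq_sup _ h id
      simp only [Finset.mem_filter, Finset.mem_univ, true_and] at hi
      change S.1 (Finset.sup _ id) ≤ y
      rw [e]
      exact hi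

/-- The object with one more point. -/
abbrev succObj (X : Obj t) : Obj t := ⟨X.size + 1, X.size.succ_pos⟩

/-- The increasing map with image the complement of `i`. -/
def face (X : Obj t) (i : Fin (X.size + 1)) : Inc X.size (succObj X).size :=
  ⟨i.succAbove, Fin.strictMono_succAbove i⟩

theorem face_val (X : Obj t) (i : Fin (X.size + 1)) : (face X i).1 = i.succAbove := rfl

/-- The subset obtained by adding the least point. -/
def Inc.cone {X Y : Obj t} (S : Inc X.size Y.size) (hS : S.1 0 ≠ 0) :
    Inc (succObj X).size Y.size :=
  ⟨Fin.cons 0 S.1, by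
    intro i j hij
    obtain ⟨j, rfl⟩ := Fin.exists_succ_eq.mpr (Fin.ne_zero_of_lt hij)
    refine Fin.cases ?_ (fun i hij => ?_) i hij
    · intro _
      rw [Fin.cons_zero, Fin.cons_succ]
      exact lt_of_lt_of_le (Fin.pos_iff_ne_zero.mpr hS) (S.2.monotone (Fin.zero_le j))
    · rw [Fin.cons_succ, Fin.cons_succ]
      exact S.2 (Fin.succ_lt_succ_iff.mp hij)⟩

noncomputable section

variable {k : Type u} [Field k] {V : Type u} [AddCommGroup V] [Module k V]
  {X : Obj t} (ρ : Representation k (Aut X) V)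

/-! ### Elements killed by monotone maps -/

/-- An element of `Δ_{X,ρ}(Y)` supported on subsets containing the least point vanishes if it is
killed by all monotone maps to `X`: the retraction onto a maximal subset `S` of the support kills
all the other subsets of the support. -/
theorem eq_zero_of_support {Y : Obj t} {x : (standardTwist ρ).obj Y}
    (hx : ∀ S : Inc X.size Y.size, S.1 0 ≠ 0 → coord ρ S x = 0)
    (h : ∀ g : Y ⟶ X, Monotone (toFun g) → (standardTwist ρ).map g x = 0) : x = 0 := by
  by_contra hne
  obtain ⟨S₀, hS₀⟩ : ∃ S : Inc X.size Y.size, coord ρ S x ≠ 0 := by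
    by_contra! hall
    exact hne (eq_zero_of_coord ρ hall)
  obtain ⟨S, hS, hmax⟩ :=
    (Set.toFinite {S : Inc X.size Y.size | coord ρ S x ≠ 0}).exists_maximal ⟨S₀, hS₀⟩
  have hS0 : S.1 0 = 0 := by
    by_contra h0
    exact hS (hx S h0)
  obtain ⟨g, hg, hgS, hle⟩ := S.exists_retraction
  have hle' : ∀ y, S.1 (g y) ≤ y := fun y => by
    by_cases hy : g y = 0
    · rw [hy, hS0]
      exact Fin.zero_le y
    · exact hle y hy
  have h1 := congrArg (coord ρ (Inc.refl X.size)) (h (monoHom g hg) hg)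
  rw [coord_map_monotone ρ (g := monoHom g hg) hg, map_zero, Fintype.sum_eq_single S] at h1
  · rw [if_pos] at h1
    · exact hS h1
    · funext i
      exact hgS i
  · intro T hT
    by_contra hTne
    obtain ⟨e, hTx⟩ := ite_ne_right_iff.mp hTne
    have hST : S ≤ T := fun i => by
      have e' : g (T.1 i) = i := congrFun e i
      have := hle' (T.1 i)
      rwa [e'] at this
    exact hT (le_antisymm (hmax hTx hST) hST)

/-- The coordinates at the subsets not containing the least point vanish if the element is
killed by all monotone maps to the object with one more point than `X`. -/
theorem coord_eq_zero_of_map_succObj {Y : Obj t} {x : (standardTwist ρ).obj Y}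
    (h : ∀ g : Y ⟶ succObj X, Monotone (toFun g) → (standardTwist ρ).map g x = 0)
    (S : Inc X.size Y.size) (h0 : S.1 0 ≠ 0) : coord ρ S x = 0 := by
  by_contra hne
  obtain ⟨S, ⟨h0, hS⟩, hmax⟩ :=
    (Set.toFinite {S : Inc X.size Y.size | S.1 0 ≠ 0 ∧ coord ρ S x ≠ 0}).exists_maximal
      ⟨S, h0, hne⟩
  obtain ⟨g, hg, hgS, hle⟩ := (S.cone h0).exists_retraction
  have h1 := congrArg (coord ρ (face X 0)) (h (monoHom g hg) hg)
  rw [coord_map_monotone ρ (g := monoHom g hg) hg, map_zero, Fintype.sum_eq_single S] at h1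
  · rw [if_pos] at h1
    · exact hS h1
    · funext i
      exact hgS i.succ
  · intro T hT
    by_contra hTne
    obtain ⟨e, hTx⟩ := ite_ne_right_iff.mp hTne
    have hST : S ≤ T := fun i => by
      have e' : g (T.1 i) = i.succ := congrFun e i
      have := hle (T.1 i) (by rw [e']; exact Fin.succ_ne_zero i)
      rwa [e'] at this
    refine hT (le_antisymm (hmax ⟨fun hT0 => h0 ?_, hTx⟩ hST) hST)
    exact le_antisymm (hT0 ▸ hST 0) (Fin.zero_le _)

/-! ### The boundary of the simplex -/

/-- The boundary `∑ (-1)^i d_i ⊗ v` of the simplex with one more vertex than `X`. -/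
def boundary : V →ₗ[k] (standardTwist ρ).obj (succObj X) :=
  ∑ i : Fin (X.size + 1), (-1 : k) ^ (i : ℕ) • gen ρ (face X i).hom

theorem boundary_apply (v : V) :
    boundary ρ v = ∑ i : Fin (X.size + 1), (-1 : k) ^ (i : ℕ) • gen ρ (face X i).hom v := by
  simp [boundary]

theorem map_boundary {Y : Obj t} (g : succObj X ⟶ Y) (v : V) :
    (standardTwist ρ).map g (boundary ρ v) =
      ∑ i : Fin (X.size + 1), (-1 : k) ^ (i : ℕ) • gen ρ ((face X i).hom ≫ g) v := by
  rw [boundary_apply, map_sum]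
  exact Finset.sum_congr rfl fun i _ => by rw [map_smul, map_gen]

/-- The sign of a self-map of `Fin n`: the usual one for a permutation, zero otherwise. -/
def mapSign (k : Type*) [Field k] {n : ℕ} (f : Fin n → Fin n) : k :=
  (Matrix.of fun r c => if f c = r then (1 : k) else 0).det

theorem mapSign_of_not_injective {n : ℕ} {f : Fin n → Fin n} (hf : ¬ Function.Injective f) :
    mapSign k f = 0 := by
  obtain ⟨i, j, hij, hne⟩ : ∃ i j, f i = f j ∧ i ≠ j := by
    simpa [Function.Injective] using hf
  exact Matrix.det_zero_of_column_eq hne fun r => by simp [hij]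

theorem mapSign_perm {n : ℕ} (σ : Equiv.Perm (Fin n)) :
    mapSign k σ = ((Equiv.Perm.sign σ : ℤ) : k) := by
  rw [← Matrix.det_permutation, ← Matrix.det_transpose, mapSign]
  congr 1
  ext i j
  simp [Equiv.toPEquiv_apply]

/-- The alternating sum of the signs of `g` on the facets of a simplex is zero: it is the expansion
along the first row of a determinant whose first row is the sum of the other ones. -/
theorem sum_mapSign_succAbove {n : ℕ} (g : Fin (n + 1) → Fin n) :
    ∑ i : Fin (n + 1), (-1 : k) ^ (i : ℕ) * mapSign k (g ∘ i.succAbove) = 0 := by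
  let A : Matrix (Fin (n + 1)) (Fin (n + 1)) k :=
    Matrix.of (Fin.cons (fun _ => 1) fun r c => if g c = r then 1 else 0)
  have h1 : A.det = ∑ i : Fin (n + 1), (-1 : k) ^ (i : ℕ) * mapSign k (g ∘ i.succAbove) := by
    rw [Matrix.det_succ_row_zero]
    refine Finset.sum_congr rfl fun i _ => ?_
    have : A 0 i = 1 := rfl
    rw [this, mul_one]
    rfl
  rw [← h1]
  refine Matrix.exists_vecMul_eq_zero_iff.mp ⟨Fin.cons 1 fun _ => -1, ?_, ?_⟩
  · intro h
    exact one_ne_zero (congrFun h 0)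
  · funext c
    simp [Matrix.vecMul, dotProduct, Fin.sum_univ_succ, A]

/-- A map kills the boundary if its effect on the facets depends only on the sign. -/
theorem map_boundary_eq_zero (g : succObj X ⟶ X) (v w : V)
    (h : ∀ f : X ⟶ X, Function.Injective (toFun f) → ∀ i, f = (face X i).hom ≫ g →
      gen ρ f v = mapSign k (toFun f) • gen ρ (𝟙 X) w) :
    (standardTwist ρ).map g (boundary ρ v) = 0 := by
  rw [map_boundary]
  have h' : ∀ i : Fin (X.size + 1), gen ρ ((face X i).hom ≫ g) v
      = mapSign k (toFun g ∘ i.succAbove) • gen ρ (𝟙 X) w := fun i => by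
    by_cases hf : Function.Injective (toFun ((face X i).hom ≫ g))
    · exact h _ hf i rfl
    · rw [gen_of_not_injective ρ hf, mapSign_of_not_injective (f := toFun g ∘ i.succAbove) hf]
      simp
  simp only [h', smul_smul]
  rw [← Finset.sum_smul, sum_mapSign_succAbove, zero_smul]

theorem map_boundary_of_monotone (g : succObj X ⟶ X) (hg : Monotone (toFun g)) (v : V) :
    (standardTwist ρ).map g (boundary ρ v) = 0 := by
  refine map_boundary_eq_zero ρ g v v fun f hf i e => ?_
  have hm : StrictMono (toFun f) := by
    refine Monotone.strictMono_of_injective ?_ hf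
    rw [e]
    exact hg.comp (face X i).2.monotone
  have hid : toFun f = ((1 : Equiv.Perm (Fin X.size)) : Fin X.size → Fin X.size) :=
    congrArg Subtype.val (Inc.eq_refl ⟨_, hm⟩)
  rw [hid, mapSign_perm, Equiv.Perm.sign_one, hom_ext (g := 𝟙 X) hid]
  simp

theorem boundary_injective : Function.Injective (boundary ρ) := by
  rw [injective_iff_map_eq_zero]
  intro v hv
  have h := congrArg (coord ρ (face X 0)) hv
  rw [boundary_apply, map_sum, map_zero, Fintype.sum_eq_single 0] at h
  · simpa [coord_gen_inc] using h
  · intro i hi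
    have : face X i ≠ face X 0 := fun e =>
      hi (Fin.succAbove_left_injective (congrArg Subtype.val e))
    simp [coord_gen_inc, this]

open Classical in
/-- Exactness of the cone: an element killed by all monotone maps to `X` is a sum of boundaries of
cones, with coefficients its coordinates at the subsets not containing the least point. -/
theorem eq_sum_map_boundary {Y : Obj t} {x : (standardTwist ρ).obj Y}
    (h : ∀ g : Y ⟶ X, Monotone (toFun g) → (standardTwist ρ).map g x = 0) :
    x = ∑ S : Inc X.size Y.size, if hS : S.1 0 ≠ 0 then
      (standardTwist ρ).map (S.cone hS).hom (boundary ρ (coord ρ S x)) else 0 := by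
  rw [← sub_eq_zero]
  refine eq_zero_of_support ρ (fun T hT => ?_) fun g hg => ?_
  · rw [map_sub, map_sum, Fintype.sum_eq_single T, dif_pos hT, map_boundary, map_sum,
      Fintype.sum_eq_single 0]
    · have : ((face X 0).hom ≫ (T.cone hT).hom : X ⟶ Y) = T.hom := rfl
      simp [this, coord_gen_inc]
    · intro i hi
      rw [map_smul, coord_gen_monotone]
      · rw [if_neg, smul_zero]
        intro e
        apply hT
        rw [← e]
        change (T.cone hT).1 (i.succAbove 0) = 0
        rw [Fin.succAbove_ne_zero_zero hi]
        rfl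
      · exact (T.cone hT).2.monotone.comp (face X i).2.monotone
    · intro S hS
      split_ifs with hS0
      · rw [map_boundary, map_sum]
        refine Finset.sum_eq_zero fun i _ => ?_
        rw [map_smul, coord_gen_monotone]
        · rw [if_neg, smul_zero]
          intro e
          by_cases hi : i = 0
          · subst hi
            exact hS (Subtype.ext e)
          · apply hT
            rw [← e]
            change (S.cone hS0).1 (i.succAbove 0) = 0
            rw [Fin.succAbove_ne_zero_zero hi]
            rfl
        · exact (S.cone hS0).2.monotone.comp (face X i).2.monotone
      · rw [map_zero]
  · rw [map_sub, h g hg, map_sum, zero_sub, neg_eq_zero]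
    refine Finset.sum_eq_zero fun S _ => ?_
    split_ifs with hS0
    · rw [← ConcreteCategory.comp_apply, ← Functor.map_comp]
      exact map_boundary_of_monotone ρ ((S.cone hS0).hom ≫ g) (hg.comp (S.cone hS0).2.monotone) _
    · rw [map_zero]

end

/-! ### The automorphism groups -/

theorem toPerm_one (X : Obj t) : toPerm (1 : Aut X) = 1 := rfl

theorem toPerm_mul {X : Obj t} (a b : Aut X) : toPerm (a * b) = toPerm a * toPerm b := rfl

theorem toPerm_pow {X : Obj t} (a : Aut X) (m : ℕ) : toPerm (a ^ m) = toPerm a ^ m := by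
  induction m with
  | zero => rw [pow_zero, pow_zero, toPerm_one]
  | succ m ih => rw [pow_succ, pow_succ, toPerm_mul, ih]

theorem toPerm_injective {X : Obj t} : Function.Injective (toPerm : Aut X → _) := by
  intro a b h
  exact Iso.ext (hom_ext (funext fun i => Equiv.congr_fun h i))

theorem toPerm_rotCA (X : Obj .CA) : toPerm (rotCA X) = finRotate X.size := rfl

theorem toPerm_rotSA (X : Obj .SA) : toPerm (rotSA X) = finRotate X.size := rfl

theorem toPerm_revSA (X : Obj .SA) : toPerm (revSA X) = reversal X.size := rfl

theorem reversal_mul_self (m : ℕ) : reversal m * reversal m = 1 := by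
  ext i
  simp

theorem perm_eq_one_of_monotone {n : ℕ} {σ : Equiv.Perm (Fin n)} (h : Monotone σ) : σ = 1 :=
  Equiv.ext (congrFun (congrArg Subtype.val
    (Inc.eq_refl ⟨σ, h.strictMono_of_injective σ.injective⟩)))

theorem exists_eq_finRotate_pow {n : ℕ} {σ : Equiv.Perm (Fin n)} (h : IsCyclicMonotone σ) :
    ∃ m : ℕ, σ = finRotate n ^ m := by
  obtain ⟨p, hp⟩ := h
  have h1 : σ * finRotate n ^ p = 1 := perm_eq_one_of_monotone hp
  obtain ⟨m, hm⟩ : σ ∈ Submonoid.powers (finRotate n) :=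
    (isOfFinOrder_of_finite (finRotate n)).mem_powers_iff_mem_zpowers.mpr
      ⟨-p, (zpow_neg _ _).trans (eq_inv_of_mul_eq_one_left h1).symm⟩
  exact ⟨m, hm.symm⟩

theorem exists_eq_rotCA_pow {X : Obj .CA} (a : Aut X) : ∃ m : ℕ, a = rotCA X ^ m := by
  obtain ⟨m, hm⟩ := exists_eq_finRotate_pow (σ := toPerm a) a.hom.2
  exact ⟨m, toPerm_injective (by rw [toPerm_pow, hm, toPerm_rotCA])⟩

theorem exists_eq_rotSA_pow {X : Obj .SA} {a : Aut X} (h : IsCyclicMonotone (toFun a.hom)) :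
    ∃ m : ℕ, a = rotSA X ^ m := by
  obtain ⟨m, hm⟩ := exists_eq_finRotate_pow (σ := toPerm a) h
  exact ⟨m, toPerm_injective (by rw [toPerm_pow, hm, toPerm_rotSA])⟩

theorem revSA_mul_self (X : Obj .SA) : revSA X * revSA X = 1 :=
  toPerm_injective (reversal_mul_self X.size)

theorem revBA_mul_self (X : Obj .BA) : revBA X * revBA X = 1 :=
  toPerm_injective (reversal_mul_self X.size)

theorem rotSA_mul_revSA_mul_rotSA (X : Obj .SA) : rotSA X * revSA X * rotSA X = revSA X := by
  apply toPerm_injective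
  rw [toPerm_mul, toPerm_mul, toPerm_rotSA, toPerm_revSA]
  have h := reversal_mul_rotate X.size
  rw [mul_inv_eq_iff_eq_mul] at h
  rw [mul_assoc, h, mul_inv_cancel_left]

theorem aut_SA_cases {X : Obj .SA} (a : Aut X) :
    ∃ m : ℕ, a = rotSA X ^ m ∨ a = revSA X * rotSA X ^ m := by
  rcases a.hom.2 with h | h
  · obtain ⟨m, hm⟩ := exists_eq_rotSA_pow h
    exact ⟨m, .inl hm⟩
  · obtain ⟨m, hm⟩ := exists_eq_rotSA_pow (a := revSA X * a) h
    refine ⟨m, .inr ?_⟩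
    rw [← hm, ← mul_assoc, revSA_mul_self, one_mul]

theorem aut_BA_cases {X : Obj .BA} (a : Aut X) : a = 1 ∨ a = revBA X := by
  rcases a.hom.2 with h | h
  · exact .inl (toPerm_injective (perm_eq_one_of_monotone (σ := toPerm a) h))
  · right
    have h1 : revBA X * a = 1 :=
      toPerm_injective (perm_eq_one_of_monotone (σ := toPerm (revBA X * a)) (Fin.rev_anti.comp h))
    rw [← one_mul a, ← revBA_mul_self, mul_assoc, h1, mul_one]

theorem aut_OA_eq_one {X : Obj .OA} (a : Aut X) : a = 1 :=
  toPerm_injective (perm_eq_one_of_monotone (σ := toPerm a) a.hom.2)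

theorem sign_finRotate_cast (k : Type*) [Field k] (n : ℕ) :
    ((Equiv.Perm.sign (finRotate n) : ℤ) : k) = (-1) ^ (n - 1) := by
  rw [sign_finRotate]
  push_cast
  rfl

noncomputable section

variable {k : Type u} [Field k] {V : Type u} [AddCommGroup V] [Module k V]

/-! ### One-dimensional representations -/

section Rep

variable {G : Type*} [Group G] {ρ : Representation k G V}

/-- An irreducible representation with a vector spanning a stable line is a character. -/
theorem isScalar_of_eigenvector (hρ : ρ.IsIrreducible) {v : V} (hv : v ≠ 0)
    (h : ∀ a, ∃ c : k, ρ a v = c • v) :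
    Module.finrank k V = 1 ∧ ∀ (a : G) (c : k), ρ a v = c • v → ρ a = c • (1 : V →ₗ[k] V) := by
  let L : Subrepresentation ρ := ⟨k ∙ v, fun a w hw => by
    obtain ⟨d, rfl⟩ := Submodule.mem_span_singleton.mp hw
    obtain ⟨c, hc⟩ := h a
    rw [map_smul, hc, smul_smul]
    exact Submodule.smul_mem _ _ (Submodule.mem_span_singleton_self v)⟩
  have hL : L = ⊤ := by
    refine (IsSimpleOrder.eq_bot_or_eq_top L).resolve_left fun hbot => hv ?_
    have h1 : v ∈ (⊥ : Subrepresentation ρ).toSubmodule := by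
      rw [← hbot]
      exact Submodule.mem_span_singleton_self v
    exact h1
  have hspan : ∀ w : V, ∃ c : k, c • v = w := fun w => by
    have h1 : w ∈ L.toSubmodule := by
      rw [hL]
      exact Submodule.mem_top
    exact Submodule.mem_span_singleton.mp h1
  refine ⟨(finrank_eq_one_iff_of_nonzero' v hv).mpr hspan, fun a c hc => ?_⟩
  ext w
  obtain ⟨d, rfl⟩ := hspan w
  rw [map_smul, hc]
  rw [smul_comm]
  rfl

theorem pow_apply_eigenvector {a : G} {v : V} {c : k} (h : ρ a v = c • v) (m : ℕ) :
    ρ (a ^ m) v = c ^ m • v := by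
  induction m with
  | zero => simp
  | succ m ih => rw [pow_succ, map_mul, Module.End.mul_apply, h, map_smul, ih, smul_smul, pow_succ']

/-- For an involution `a` and `v ≠ 0`, either `v + a v` is a nonzero fixed vector or `a v = -v`. -/
theorem exists_eigenvector_of_involution {a : G} (ha : a * a = 1) {v : V} (hv : v ≠ 0) :
    ∃ u : V, u ≠ 0 ∧ (u = v ∨ u = v + ρ a v) ∧ (ρ a u = (1 : k) • u ∨ ρ a u = (-1 : k) • u) := by
  by_cases h : v + ρ a v = 0
  · exact ⟨v, hv, .inl rfl, .inr (by rw [neg_one_smul]; exact (neg_eq_of_add_eq_zero_right h).symm)⟩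
  · refine ⟨_, h, .inr rfl, .inl ?_⟩
    rw [one_smul, map_add, ← Module.End.mul_apply, ← map_mul, ha, map_one, Module.End.one_apply,
      add_comm]

end Rep

/-! ### Characters killing the boundary -/

variable {X : Obj t} {ρ : Representation k (Aut X) V}

/-- A morphism kills the boundary if the automorphisms it induces on the facets act by their
signs. -/
theorem map_boundary_of_sign (g : succObj X ⟶ X) (v : V)
    (h : ∀ (i : Fin (X.size + 1)) (a : Aut X), a.hom = (face X i).hom ≫ g →
      ρ a v = ((Equiv.Perm.sign (toPerm a) : ℤ) : k) • v) :
    (standardTwist ρ).map g (boundary ρ v) = 0 := by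
  refine map_boundary_eq_zero ρ g v v fun f hf i e => ?_
  obtain ⟨a, rfl⟩ := exists_aut_hom_eq f hf
  have h1 : mapSign k (toFun a.hom) = ((Equiv.Perm.sign (toPerm a) : ℤ) : k) :=
    mapSign_perm (toPerm a)
  have h2 := gen_aut_comp ρ a (𝟙 X) v
  rw [Category.comp_id] at h2
  rw [h1, h2, h i a e, map_smul]

theorem map_boundary_of_comp {g : succObj X ⟶ X} (r : X ⟶ X) (hr : toFun r ∘ toFun r = id) {v : V}
    (h : (standardTwist ρ).map (g ≫ r) (boundary ρ v) = 0) :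
    (standardTwist ρ).map g (boundary ρ v) = 0 := by
  have e : g = (g ≫ r) ≫ r := hom_ext (by
    rw [toFun_comp, toFun_comp, ← Function.comp_assoc, hr, Function.id_comp])
  rw [e, Functor.map_comp, ConcreteCategory.comp_apply, h, map_zero]

theorem apply_eq_sign_of_rotate {a : Aut X} (ha : toPerm a = finRotate X.size)
    (h : ρ a = ((-1 : k) ^ (X.size - 1)) • (1 : V →ₗ[k] V)) (m : ℕ) (v : V) :
    ρ (a ^ m) v = ((Equiv.Perm.sign (toPerm (a ^ m)) : ℤ) : k) • v := by
  rw [pow_apply_eigenvector (c := (-1 : k) ^ (X.size - 1)) (by rw [h]; rfl), toPerm_pow, ha,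
    map_pow, Units.val_pow_eq_pow_val, Int.cast_pow, sign_finRotate_cast]

/-- For singular `ρ` the boundary is killed by all morphisms to `X`. As a morphism can be composed
with the reversal of `X`, only monotone maps matter for `BA` and cyclically monotone ones for
`SA`. -/
theorem map_boundary_of_isSingular (h : IsSingular ρ) (g : succObj X ⟶ X) (v : V) :
    (standardTwist ρ).map g (boundary ρ v) = 0 := by
  cases t with
  | FA => exact map_boundary_of_sign g v fun _ a _ => by rw [h.2 a]; rfl
  | OA => exact map_boundary_of_monotone ρ g g.2 v
  | CA =>
    refine map_boundary_of_sign g v fun _ a _ => ?_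
    obtain ⟨m, rfl⟩ := exists_eq_rotCA_pow a
    exact apply_eq_sign_of_rotate (toPerm_rotCA X) h.2 m v
  | BA =>
    rcases g.2 with hg | hg
    · exact map_boundary_of_monotone ρ g hg v
    · refine map_boundary_of_comp (revBA X).hom (funext Fin.rev_rev) ?_
      exact map_boundary_of_monotone ρ (g ≫ (revBA X).hom) (Fin.rev_anti.comp hg) v
  | SA =>
    have key : ∀ g : succObj X ⟶ X, IsCyclicMonotone (toFun g) →
        (standardTwist ρ).map g (boundary ρ v) = 0 := by
      intro g hg
      refine map_boundary_of_sign g v fun i a ha => ?_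
      obtain ⟨m, rfl⟩ := exists_eq_rotSA_pow (a := a) (by
        rw [ha]
        exact hg.comp (.of_monotone (face X i).2.monotone))
      exact apply_eq_sign_of_rotate (toPerm_rotSA X) h.2.1 m v
    rcases g.2 with hg | hg
    · exact key g hg
    · exact map_boundary_of_comp (revSA X).hom (funext Fin.rev_rev) (key (g ≫ (revSA X).hom) hg)

/-- A morphism which identifies the vertices `i` and `j` of a simplex is injective at most on the
two facets omitting one of them, so that killing the boundary is a relation between the two
automorphisms it induces there. -/
theorem add_eq_zero_of_map_boundary {g : succObj X ⟶ X} {v : V}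
    (h : (standardTwist ρ).map g (boundary ρ v) = 0) {i j : Fin (X.size + 1)} (hij : i ≠ j)
    (hg : toFun g i = toFun g j) {a b : Aut X} (ha : (face X i).hom ≫ g = a.hom)
    (hb : (face X j).hom ≫ g = b.hom) :
    (-1 : k) ^ (i : ℕ) • ρ a v + (-1 : k) ^ (j : ℕ) • ρ b v = 0 := by
  have h1 : ∀ a : Aut X, gen ρ a.hom v = gen ρ (Inc.refl _).hom (ρ a v) := fun a => by
    rw [Inc.hom_refl, ← gen_aut_comp, Category.comp_id]
  rw [map_boundary, Fintype.sum_eq_add i j hij, ha, hb, h1, h1,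
    ← (gen ρ _).map_smul, ← (gen ρ _).map_smul, ← map_add] at h
  · exact gen_injective ρ _ (h.trans (map_zero _).symm)
  · rintro l ⟨hi, hj⟩
    rw [gen_of_not_injective]
    · simp
    · intro hl
      obtain ⟨i', hi'⟩ := Fin.exists_succAbove_eq hi.symm
      obtain ⟨j', hj'⟩ := Fin.exists_succAbove_eq hj.symm
      have : i' = j' := hl (by
        change toFun g (l.succAbove i') = toFun g (l.succAbove j')
        rw [hi', hj', hg])
      exact hij (by rw [← hi', ← hj', this])

/-- The map `0, 1, …, n - 1, 0` identifying the first and the last vertex of a simplex. -/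
theorem isCyclicMonotone_snoc (n : ℕ) [NeZero n] :
    IsCyclicMonotone (Fin.snoc (α := fun _ => Fin n) id 0 : Fin (n + 1) → Fin n) := by
  refine ⟨(n : ℤ), fun i j hij => ?_⟩
  have key : ∀ i : Fin (n + 1), ((Fin.snoc (α := fun _ => Fin n) id 0
      ((finRotate (n + 1) ^ (n : ℤ)) i) : Fin n) : ℕ) = (i : ℕ) - 1 := by
    intro i
    rw [zpow_natCast]
    have h := finRotate_pow_val n i
    generalize (finRotate (n + 1) ^ n) i = x at h
    rcases Nat.eq_zero_or_pos i with hi | hi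
    · rw [hi, Nat.zero_add, Nat.mod_eq_of_lt n.lt_succ_self] at h
      have : x = Fin.last n := Fin.ext h
      rw [this, Fin.snoc_last, hi]
      rfl
    · have h2 : ((i : ℕ) + n) % (n + 1) = i - 1 := by
        rw [show (i : ℕ) + n = (i - 1) + (n + 1) by omega, Nat.add_mod_right,
          Nat.mod_eq_of_lt (by omega)]
      have : x = Fin.castSucc ⟨i - 1, by omega⟩ := Fin.ext (h.trans h2)
      rw [this, Fin.snoc_castSucc]
      rfl
  rw [Fin.le_def]
  simp only [Function.comp_apply, key]
  have : (i : ℕ) ≤ j := hij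
  omega

theorem snoc_comp_succ (n : ℕ) [NeZero n] :
    (Fin.snoc (α := fun _ => Fin n) id 0 : Fin (n + 1) → Fin n) ∘ Fin.succAbove 0
      = finRotate n := by
  obtain ⟨n, rfl⟩ := Nat.exists_eq_succ_of_ne_zero (NeZero.ne n)
  funext i
  refine Fin.lastCases ?_ (fun i => ?_) i
  · rw [finRotate_last, Function.comp_apply, Fin.succAbove_zero, Fin.succ_last, Fin.snoc_last]
  · rw [Function.comp_apply, Fin.succAbove_zero, Fin.succ_castSucc, Fin.snoc_castSucc,
      finRotate_apply]
    exact (Fin.coeSucc_eq_succ).symm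

/-- The relation coming from the identification of the first and the last vertex. -/
theorem rotate_apply_of_map_boundary {g : succObj X ⟶ X}
    (hg : toFun g = Fin.snoc (α := fun _ => Fin X.size) id 0) {v : V}
    (h : (standardTwist ρ).map g (boundary ρ v) = 0) {a : Aut X}
    (ha : toPerm a = finRotate X.size) : ρ a v = ((-1 : k) ^ (X.size - 1)) • v := by
  have h0 : (0 : Fin (X.size + 1)) ≠ Fin.last X.size := by
    rw [Ne, Fin.ext_iff]
    exact (NeZero.ne X.size).symm
  have h1 := add_eq_zero_of_map_boundary h h0 (a := a) (b := 1) ?_ ?_ ?_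
  · rw [map_one, Module.End.one_apply, Fin.val_zero, pow_zero, one_smul, Fin.val_last] at h1
    rw [eq_neg_of_add_eq_zero_left h1, ← neg_smul]
    congr 1
    obtain ⟨n, hn⟩ := Nat.exists_eq_succ_of_ne_zero (NeZero.ne X.size)
    rw [hn, Nat.succ_sub_one, pow_succ]
    ring
  · rw [hg, Fin.snoc_last, ← Fin.castSucc_zero', Fin.snoc_castSucc]
    rfl
  · refine hom_ext ?_
    rw [toFun_comp, hg]
    exact (snoc_comp_succ X.size).trans (congrArg _ ha.symm)
  · refine hom_ext ?_
    rw [toFun_comp, hg]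
    funext i
    change Fin.snoc (α := fun _ => Fin X.size) id 0 ((Fin.last X.size).succAbove i) = i
    rw [Fin.succAbove_last, Fin.snoc_castSucc]
    rfl

/-- Identifying two points at distance two, and omitting the second one, gives an adjacent
transposition. -/
theorem ite_predAbove_succAbove_eq_swap {m : ℕ} (p : Fin m) (x : Fin (m + 1)) :
    (if p.succ.succ.succAbove x = p.castSucc.castSucc then p.succ
      else p.castSucc.predAbove (p.succ.succ.succAbove x)) = Equiv.swap p.castSucc p.succ x := by
  have hy : ((p.succ.succ.succAbove x : Fin (m + 2)) : ℕ) =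
      if (x : ℕ) < p + 2 then (x : ℕ) else x + 1 := by
    simp only [Fin.succAbove, Fin.lt_def, Fin.val_castSucc, Fin.val_succ]
    split_ifs <;> rfl
  generalize p.succ.succ.succAbove x = y at hy
  rw [Equiv.swap_apply_def]
  simp only [Fin.predAbove, Fin.lt_def, Fin.ext_iff, Fin.val_castSucc, Fin.val_succ]
  split_ifs at hy ⊢ <;> simp <;> omega

/-- The relation coming from the identification of two vertices at distance two. -/
theorem swap_apply_of_map_boundary {m : ℕ}
    {ρ : Representation k (Aut (⟨m + 1, m.succ_pos⟩ : Obj .FA)) V} {v : V}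
    (h : ∀ g : succObj ⟨m + 1, m.succ_pos⟩ ⟶ ⟨m + 1, m.succ_pos⟩,
      (standardTwist ρ).map g (boundary ρ v) = 0) (p : Fin m) :
    ρ (autOfPerm ⟨m + 1, m.succ_pos⟩ (Equiv.swap p.castSucc p.succ) trivial trivial) v = -v := by
  -- this map identifies the vertices `p` and `p + 2`; it is the identity on the facet omitting
  -- `p`, and an adjacent transposition on the facet omitting `p + 2`
  let g : Fin (m + 2) → Fin (m + 1) := fun x =>
    if x = p.castSucc.castSucc then p.succ else p.castSucc.predAbove x
  have h1 := add_eq_zero_of_map_boundary (h ⟨g, trivial⟩) (i := p.castSucc.castSucc)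
    (j := p.succ.succ) (a := 1)
    (b := autOfPerm ⟨m + 1, m.succ_pos⟩ (Equiv.swap p.castSucc p.succ) trivial trivial) ?_ ?_ ?_ ?_
  · have e : ((p.succ.succ : Fin (m + 2)) : ℕ) = p + 2 := rfl
    have e' : ((p.castSucc.castSucc : Fin (m + 2)) : ℕ) = p := rfl
    rw [map_one, Module.End.one_apply, e, e', pow_add, neg_one_sq, mul_one, ← smul_add,
      smul_eq_zero_iff_right (pow_ne_zero _ (neg_ne_zero.mpr one_ne_zero))] at h1
    exact eq_neg_of_add_eq_zero_right h1
  · rw [Ne, Fin.ext_iff, Fin.val_castSucc, Fin.val_castSucc, Fin.val_succ, Fin.val_succ]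
    omega
  · change g _ = g _
    simp only [g, Fin.predAbove]
    grind
  · refine hom_ext (funext fun x => ?_)
    change g (p.castSucc.castSucc.succAbove x) = x
    simp only [g]
    rw [if_neg (Fin.succAbove_ne _ _), Fin.predAbove_succAbove]
  · refine hom_ext (funext fun x => ?_)
    change g (p.succ.succ.succAbove x) = Equiv.swap p.castSucc p.succ x
    exact ite_predAbove_succAbove_eq_swap p x

/-- If the boundary with coefficients in some `v ≠ 0` is killed by all morphisms to `X`, the
irreducible representation `ρ` is singular. -/
theorem isSingular_of_map_boundary (hρ : ρ.IsIrreducible) {v : V} (hv : v ≠ 0)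
    (h : ∀ g : succObj X ⟶ X, (standardTwist ρ).map g (boundary ρ v) = 0) : IsSingular ρ := by
  cases t with
  | FA =>
    obtain ⟨_ | m, hX⟩ := X
    · exact absurd hX (lt_irrefl _)
    have hsign : ∀ σ : Equiv.Perm (Fin (m + 1)),
        ρ (autOfPerm ⟨m + 1, hX⟩ σ trivial trivial) v = ((Equiv.Perm.sign σ : ℤ) : k) • v := by
      intro σ
      have hσ : σ ∈ Submonoid.closure
          (Set.range fun i : Fin m => Equiv.swap i.castSucc i.succ) := by
        rw [Equiv.Perm.mclosure_swap_castSucc_succ]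
        exact Submonoid.mem_top σ
      induction hσ using Submonoid.closure_induction with
      | mem σ hσ =>
        obtain ⟨p, rfl⟩ := hσ
        refine (swap_apply_of_map_boundary h p).trans ?_
        rw [Equiv.Perm.sign_swap p.castSucc_lt_succ.ne]
        simp
      | one =>
        have : autOfPerm (t := .FA) ⟨m + 1, hX⟩ 1 trivial trivial = 1 := rfl
        rw [this]
        simp
      | mul σ σ' _ _ e e' =>
        have : autOfPerm (t := .FA) ⟨m + 1, hX⟩ (σ * σ') trivial trivial =
          autOfPerm (t := .FA) ⟨m + 1, hX⟩ σ trivial trivial *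
            autOfPerm (t := .FA) ⟨m + 1, hX⟩ σ' trivial trivial := rfl
        rw [this, map_mul, Module.End.mul_apply, e', map_smul, e, smul_smul]
        simp [mul_comm]
    have hsign' : ∀ a, ρ a v = ((Equiv.Perm.sign (toPerm a) : ℤ) : k) • v :=
      fun a => hsign (toPerm a)
    obtain ⟨h1, h2⟩ := isScalar_of_eigenvector hρ hv fun a => ⟨_, hsign' a⟩
    exact ⟨h1, fun a => h2 a _ (hsign' a)⟩
  | OA =>
    obtain ⟨h1, -⟩ := isScalar_of_eigenvector hρ hv fun a =>
      ⟨1, by rw [aut_OA_eq_one a, map_one, one_smul]; rfl⟩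
    exact ⟨h1, fun a => by rw [aut_OA_eq_one a, map_one]⟩
  | CA =>
    have hrot := rotate_apply_of_map_boundary rfl (h ⟨_, isCyclicMonotone_snoc X.size⟩)
      (toPerm_rotCA X)
    obtain ⟨h1, h2⟩ := isScalar_of_eigenvector hρ hv fun a => by
      obtain ⟨m, rfl⟩ := exists_eq_rotCA_pow a
      exact ⟨_, pow_apply_eigenvector hrot m⟩
    exact ⟨h1, h2 _ _ hrot⟩
  | BA =>
    obtain ⟨u, hu, -, hrev⟩ := exists_eigenvector_of_involution (ρ := ρ) (revBA_mul_self X) hv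
    obtain ⟨h1, h2⟩ := isScalar_of_eigenvector hρ hu fun a => by
      rcases aut_BA_cases a with rfl | rfl
      · exact ⟨1, by rw [map_one, one_smul]; rfl⟩
      · exact hrev.elim (fun e => ⟨_, e⟩) fun e => ⟨_, e⟩
    refine ⟨h1, hrev.imp (fun e => ?_) fun e => ?_⟩
    · rw [h2 _ _ e, one_smul]
    · rw [h2 _ _ e, neg_one_smul]
  | SA =>
    have hrot := rotate_apply_of_map_boundary rfl (h ⟨_, .inl (isCyclicMonotone_snoc X.size)⟩)
      (toPerm_rotSA X)
    obtain ⟨u, hu, huv, hrev⟩ := exists_eigenvector_of_involution (ρ := ρ) (revSA_mul_self X) hv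
    -- the reflection inverts the rotation, which acts on `v` by a scalar equal to its inverse
    have hrot' : ρ (rotSA X) (ρ (revSA X) v) = ((-1 : k) ^ (X.size - 1)) • ρ (revSA X) v := by
      conv_rhs => rw [← rotSA_mul_revSA_mul_rotSA, map_mul, map_mul, Module.End.mul_apply,
        Module.End.mul_apply, hrot, map_smul, map_smul, smul_smul, ← pow_add, ← two_mul,
        pow_mul, neg_one_sq, one_pow, one_smul]
    have hrotu : ρ (rotSA X) u = ((-1 : k) ^ (X.size - 1)) • u := by
      rcases huv with rfl | rfl
      · exact hrot
      · rw [map_add, hrot, hrot', smul_add]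
    obtain ⟨h1, h2⟩ := isScalar_of_eigenvector hρ hu fun a => by
      obtain ⟨m, rfl | rfl⟩ := aut_SA_cases a
      · exact ⟨_, pow_apply_eigenvector hrotu m⟩
      · rw [map_mul, Module.End.mul_apply, pow_apply_eigenvector hrotu, map_smul]
        rcases hrev with e | e <;> rw [e, smul_smul] <;> exact ⟨_, rfl⟩
    refine ⟨h1, h2 _ _ hrotu, hrev.imp (fun e => ?_) fun e => ?_⟩
    · rw [h2 _ _ e, one_smul]
    · rw [h2 _ _ e, neg_one_smul]

theorem IsSingular.finrank_eq_one (h : IsSingular ρ) : Module.finrank k V = 1 := by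
  cases t <;> exact h.1

/-! ### The radical -/

variable (ρ) in
/-- The subfunctor of the elements killed by all morphisms to `X`. -/
def radical : StableFamily (standardTwist ρ) :=
  ⟨fun Y => ⨅ g : Y ⟶ X, LinearMap.ker ((standardTwist ρ).map g).hom, fun Y Z g x hx => by
    rw [Submodule.mem_iInf] at hx ⊢
    intro f
    have := hx (g ≫ f)
    rw [LinearMap.mem_ker, Functor.map_comp] at this
    exact this⟩

theorem mem_radical {Y : Obj t} {x : (standardTwist ρ).obj Y} :
    x ∈ (radical ρ).1 Y ↔ ∀ g : Y ⟶ X, (standardTwist ρ).map g x = 0 := by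
  simp only [radical, Submodule.mem_iInf, LinearMap.mem_ker]

/-- The radical contains all proper subfunctors, as `Δ_{X,ρ}` is generated by its value `V`
at `X`. -/
theorem le_radical_or_eq_top (hρ : ρ.IsIrreducible) (W : StableFamily (standardTwist ρ)) :
    W ≤ radical ρ ∨ W = ⊤ := by
  let L : Subrepresentation ρ := ⟨(W.1 X).comap (gen ρ (𝟙 X)), fun a v hv => by
    rw [Submodule.mem_comap, ← gen_aut_comp, Category.comp_id, ← Category.id_comp a.hom, ← map_gen]
    exact W.2 _ _ hv⟩
  have hmem : ∀ v, v ∈ L ↔ gen ρ (𝟙 X) v ∈ W.1 X := fun v => Iff.rfl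
  rcases IsSimpleOrder.eq_bot_or_eq_top L with hL | hL
  · left
    intro Y x hx
    rw [mem_radical]
    intro g
    obtain ⟨v, hv⟩ := exists_gen_id ρ ((standardTwist ρ).map g x)
    have h1 : v ∈ L := by
      rw [hmem, hv]
      exact W.2 g x hx
    rw [hL] at h1
    have h2 : v = 0 := h1
    rw [← hv, h2, map_zero]
  · right
    refine top_le_iff.mp fun Y x _ => ?_
    rw [← sum_gen_coord ρ x]
    refine Submodule.sum_mem _ fun S _ => ?_
    have h1 : coord ρ S x ∈ L := by
      rw [hL]
      exact Submodule.mem_top (R := k)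
    rw [← Category.id_comp S.hom, ← map_gen]
    exact W.2 _ _ h1

theorem radical_ne_top [Nontrivial V] : radical ρ ≠ ⊤ := by
  intro h
  obtain ⟨v, hv⟩ := exists_ne (0 : V)
  have h1 : gen ρ (𝟙 X) v ∈ (radical ρ).1 X := by
    rw [h]
    exact Submodule.mem_top
  rw [mem_radical] at h1
  have h2 := h1 (𝟙 X)
  rw [map_gen, Category.comp_id] at h2
  exact hv (gen_injective ρ (Inc.refl X.size) (h2.trans (map_zero _).symm))

/-- A nonzero subfunctor of the radical contains a nonzero boundary. -/
theorem exists_boundary_mem {W : StableFamily (standardTwist ρ)} (hW : W ≤ radical ρ)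
    (h0 : W ≠ ⊥) : ∃ v ≠ 0, boundary ρ v ∈ W.1 (succObj X) := by
  classical
  obtain ⟨Y, x, hx, hne⟩ : ∃ Y, ∃ x ∈ W.1 Y, x ≠ 0 := by
    by_contra! hall
    exact h0 (le_bot_iff.mp fun Y x hx => hall Y x hx)
  have hrad := mem_radical.mp (hW Y hx)
  obtain ⟨g, -, hg⟩ : ∃ g : Y ⟶ succObj X, Monotone (toFun g) ∧ (standardTwist ρ).map g x ≠ 0 := by
    by_contra! hall
    exact hne (eq_zero_of_support ρ (coord_eq_zero_of_map_succObj ρ hall) fun g _ => hrad g)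
  have hz := W.2 g x hx
  generalize (standardTwist ρ).map g x = z at hg hz
  have e := eq_sum_map_boundary ρ fun g _ => mem_radical.mp (hW _ hz) g
  have hface : (face X 0).1 0 ≠ 0 := by
    rw [face_val, Fin.succAbove_zero]
    exact Fin.succ_ne_zero _
  have hcone : ((face X 0).cone hface).hom = 𝟙 (succObj X) := by
    rw [Inc.eq_refl ((face X 0).cone hface), Inc.hom_refl]
  -- the zeroth facet is the only one without the least point
  have hS : ∀ S : Inc X.size (succObj X).size, S ≠ face X 0 → ¬ S.1 0 ≠ 0 := by
    intro S hS h0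
    refine hS (Subtype.ext (funext fun i => ?_))
    exact congrFun (congrArg Subtype.val (Inc.eq_refl (S.cone h0))) i.succ
  rw [Fintype.sum_eq_single (face X 0) fun S h => dif_neg (hS S h), dif_pos hface, hcone,
    CategoryTheory.Functor.map_id] at e
  have e' : z = boundary ρ (coord ρ (face X 0) z) := e
  refine ⟨coord ρ (face X 0) z, fun h => hg ?_, ?_⟩
  · rw [e', h, map_zero]
  · rw [← e']
    exact hz

/-- The radical is contained in every subfunctor containing all boundaries. -/
theorem radical_le_of_boundary_mem {W : StableFamily (standardTwist ρ)}
    (h : ∀ v, boundary ρ v ∈ W.1 (succObj X)) : radical ρ ≤ W := by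
  intro Y x hx
  rw [eq_sum_map_boundary ρ fun g _ => mem_radical.mp hx g]
  refine Submodule.sum_mem _ fun S _ => ?_
  split_ifs with hS
  · exact W.2 _ _ (h _)
  · exact Submodule.zero_mem _

theorem radical_eq_bot_of_not_isSingular (hρ : ρ.IsIrreducible) (h : ¬ IsSingular ρ) :
    radical ρ = ⊥ := by
  by_contra h0
  obtain ⟨v, hv, hmem⟩ := exists_boundary_mem le_rfl h0
  exact h (isSingular_of_map_boundary hρ hv (mem_radical.mp hmem))

theorem radical_ne_bot_of_isSingular [Nontrivial V] (h : IsSingular ρ) : radical ρ ≠ ⊥ := by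
  intro h0
  obtain ⟨v, hv⟩ := exists_ne (0 : V)
  have h1 : boundary ρ v ∈ (radical ρ).1 (succObj X) :=
    mem_radical.mpr fun g => map_boundary_of_isSingular h g v
  rw [h0] at h1
  have h2 : boundary ρ v = 0 := h1
  exact hv (boundary_injective ρ (h2.trans (map_zero _).symm))

/-- For a character `ρ` the radical has no proper nonzero subfunctor. -/
theorem eq_radical_of_le (h : Module.finrank k V = 1) {W : StableFamily (standardTwist ρ)}
    (hW : W ≤ radical ρ) (h0 : W ≠ ⊥) : W = radical ρ := by
  obtain ⟨v, hv, hmem⟩ := exists_boundary_mem hW h0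
  refine le_antisymm hW (radical_le_of_boundary_mem fun w => ?_)
  obtain ⟨c, rfl⟩ := (finrank_eq_one_iff_of_nonzero' v hv).mp h w
  rw [map_smul]
  exact Submodule.smul_mem _ _ hmem

theorem nontrivial_of_isIrreducible (hρ : ρ.IsIrreducible) : Nontrivial V := by
  by_contra h
  rw [not_nontrivial_iff_subsingleton] at h
  obtain ⟨L, L', hne⟩ := hρ.toNontrivial.exists_pair_ne
  exact hne (Subrepresentation.toSubmodule_injective (Subsingleton.elim _ _))

end

end Cameron

theorem mainTheorem4 {k : Type u} [Field k] [CharZero k] (t : Cameron.Kind) (n : Cameron.Obj t)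
    {V : Type u} [AddCommGroup V] [Module k V] (ρ : Representation k (Aut n) V)
    (hρ : ρ.IsIrreducible) :
    (¬ Cameron.IsSingular ρ → Simple (Cameron.standardTwist ρ)) ∧
    (Cameron.IsSingular ρ → Cameron.objLength (Cameron.standardTwist ρ) = 2) := by
  have := Cameron.nontrivial_of_isIrreducible hρ
  constructor
  · intro h
    have hbot := Cameron.radical_eq_bot_of_not_isSingular hρ h
    have hne : (⊥ : Cameron.StableFamily (Cameron.standardTwist ρ)) ≠ ⊤ := by
      rw [← hbot]
      exact Cameron.radical_ne_top
    have : IsSimpleOrder (Cameron.StableFamily (Cameron.standardTwist ρ)) :=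
      { exists_pair_ne := ⟨⊥, ⊤, hne⟩
        eq_bot_or_eq_top := fun W =>
          (Cameron.le_radical_or_eq_top hρ W).imp (fun hW => le_bot_iff.mp (hbot ▸ hW)) id }
    exact Cameron.StableFamily.simple_of_isSimpleOrder
  · intro h
    refine Cameron.StableFamily.objLength_eq_two (Cameron.radical ρ)
      (bot_lt_iff_ne_bot.mpr (Cameron.radical_ne_bot_of_isSingular h))
      (lt_top_iff_ne_top.mpr Cameron.radical_ne_top) fun W => ?_
    rcases Cameron.le_radical_or_eq_top hρ W with hW | hW
    · by_cases h0 : W = ⊥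
      · exact .inl h0
      · exact .inr (.inl (Cameron.eq_radical_of_le h.finrank_eq_one hW h0))
    · exact .inr (.inr hW)
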